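/- All spaces are completely regular Hausdorff. Notation. For a commutative ring $A$ with $1$, an ideal is dense if its only annihilator in $A$ is $0$; $\mathcal{Q}(A)=\varinjlim_D \operatorname{Hom}_A(D,A)$ ($D$ ranging over all dense ideals, multiplication being composition) is the maximal ring of quotients of $A$; $\mathfrak{M}(A)$ is the space of maximal ideals of $A$ with the Stone (hull-kernel) topology; and $E(A)$ is the Boolean ring of idempotents of $A$, with the multiplication of $A$ and with addition $e\dotplus f=e+f-2ef$. For a space $X$, $Q(X)=\mathcal{Q}(C(X))$, where $C(X)$ is the ring of continuous real-valued functions on $X$; $\mathcal{B}(X)$ is the Boolean algebra of regular open subsets of $X$; and $$K(X)=\varprojlim_{S}\beta S,$$ where $S$ ranges over all dense $G_\delta$-subsets of the Stone–Čech compactification $\beta X$ and the bonding maps are the continuous extensions $\beta S\to\beta T$ of the inclusions $S\subset T$. Let $B_\infty$ be the free Boolean algebra on countably infinitely many generators, regarded as a Boolean ring. Theorem. (1) For every space $X$, the space $K(X)$ is compact Hausdorff and extremally disconnected, and $\mathfrak{M}(\mathcal{B}(X))$ is homeomorphic to $K(X)$. (2) For every nonempty space $X$ that has a countable base and no isolated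 points, $E(Q(X))\cong\mathcal{Q}(B_\infty)$ as rings, $\mathfrak{M}(Q(X))$ is homeomorphic to $\mathfrak{M}(\mathcal{Q}(B_\infty))$, and $\mathfrak{M}(Q(X))$ is homeomorphic to $K(X)$. (3) Hence $E(Q(X))$ and $\mathfrak{M}(Q(X))$ are, up to isomorphism and homeomorphism respectively, the same for all nonempty spaces $X$ that have a countable base and no isolated points. (4) $\mathcal{Q}(B_\infty)$ is the completion of $B_\infty$: it is a complete Boolean algebra (ordered by $a\le b$ iff $ab=a$), and the canonical homomorphism $B_\infty\to\mathcal{Q}(B_\infty)$ is injective with order-dense image. -/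

import Mathlib

universe u v

open TopologicalSpace

/-! ### The maximal ring of quotients of a commutative ring -/

/-- An ideal is (rationally) dense if its only annihilator is `0`. -/
def Ideal.IsRationallyDense {A : Type u} [CommRing A] (D : Ideal A) : Prop :=
  ∀ a : A, (∀ d ∈ D, a * d = 0) → a = 0

/-- An `A`-homomorphism `D → A` defined on a dense ideal `D` of `A`. -/
structure DenseHom (A : Type u) [CommRing A] where
  dom : Ideal A
  dense : dom.IsRationallyDense
  hom : dom →ₗ[A] A

namespace DenseHom

variable {A : Type u} [CommRing A]

theorem dense_mul {D E : Ideal A} (hD : D.IsRationallyDense) (hE : E.IsRationallyDense)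
    (a : A) (h : ∀ d ∈ D, ∀ e ∈ E, a * (d * e) = 0) : a = 0 := by
  refine hD a fun d hd => hE (a * d) fun e he => ?_
  rw [mul_assoc]
  exact h d hd e he

theorem dense_inf {D E : Ideal A} (hD : D.IsRationallyDense) (hE : E.IsRationallyDense) :
    (D ⊓ E).IsRationallyDense := fun a h =>
  dense_mul hD hE a fun d hd e he => h (d * e) ⟨D.mul_mem_right e hd, E.mul_mem_left d he⟩

theorem hom_smul (f : DenseHom A) (a : A) {x : A} (hx : x ∈ f.dom) :
    f.hom ⟨a * x, f.dom.mul_mem_left a hx⟩ = a * f.hom ⟨x, hx⟩ := by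
  rw [← smul_eq_mul a (f.hom _), ← map_smul]
  rfl

theorem hom_mul_comm (f : DenseHom A) {x y : A} (hx : x ∈ f.dom) (hy : y ∈ f.dom) :
    f.hom ⟨x, hx⟩ * y = f.hom ⟨y, hy⟩ * x := by
  rw [mul_comm _ y, mul_comm _ x, ← hom_smul f y hx, ← hom_smul f x hy]
  congr 2
  exact mul_comm y x

/-- Two homomorphisms are identified if they agree wherever both are defined. -/
def Rel (f g : DenseHom A) : Prop :=
  ∀ (x : A) (hf : x ∈ f.dom) (hg : x ∈ g.dom), f.hom ⟨x, hf⟩ = g.hom ⟨x, hg⟩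

/-- It suffices to agree on the products of elements of two dense ideals. -/
theorem Rel.of_mul {f g : DenseHom A} {D E : Ideal A} (hD : D.IsRationallyDense)
    (hE : E.IsRationallyDense)
    (h : ∀ d ∈ D, ∀ e ∈ E, ∃ (hf : d * e ∈ f.dom) (hg : d * e ∈ g.dom),
      f.hom ⟨d * e, hf⟩ = g.hom ⟨d * e, hg⟩) : Rel f g := by
  intro x hf hg
  refine sub_eq_zero.1 (dense_mul hD hE _ fun d hd e he => ?_)
  obtain ⟨h1, h2, h3⟩ := h d hd e he
  rw [sub_mul, hom_mul_comm f hf h1, hom_mul_comm g hg h2, h3, sub_self]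

instance setoid (A : Type u) [CommRing A] : Setoid (DenseHom A) where
  r := Rel
  iseqv :=
    { refl := fun _ _ _ _ => rfl
      symm := fun h x hf hg => (h x hg hf).symm
      trans := fun {f g k} h1 h2 => Rel.of_mul (dense_inf f.dense k.dense) g.dense
        fun d hd e he =>
          have hf := f.dom.mul_mem_right e hd.1
          have hk := k.dom.mul_mem_right e hd.2
          have hg := g.dom.mul_mem_left d he
          ⟨hf, hk, (h1 _ hf hg).trans (h2 _ hg hk)⟩ }

/-- Multiplication by `a`, defined on the whole ring. -/
def ofElem (a : A) : DenseHom A where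
  dom := ⊤
  dense := fun b h => by simpa using h 1 trivial
  hom := (LinearMap.mulLeft A a).comp (Submodule.subtype _)

/-- The sum, defined on the intersection of the domains. -/
def add (f g : DenseHom A) : DenseHom A where
  dom := f.dom ⊓ g.dom
  dense := dense_inf f.dense g.dense
  hom := f.hom.comp (Submodule.inclusion inf_le_left) +
    g.hom.comp (Submodule.inclusion inf_le_right)

/-- The negative, with the same domain. -/
def neg (f : DenseHom A) : DenseHom A where
  dom := f.dom
  dense := f.dense
  hom := -f.hom

/-- The composition `f ∘ g`, defined on all `x ∈ g.dom` such that `g x ∈ f.dom`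
(a set that contains the product `f.dom * g.dom`). -/
def comp (f g : DenseHom A) : DenseHom A where
  dom :=
    { carrier := {x | ∃ hx : x ∈ g.dom, g.hom ⟨x, hx⟩ ∈ f.dom}
      add_mem' := by
        rintro x y ⟨hx, hx'⟩ ⟨hy, hy'⟩
        refine ⟨add_mem hx hy, ?_⟩
        rw [show g.hom ⟨x + y, _⟩ = _ from g.hom.map_add ⟨x, hx⟩ ⟨y, hy⟩]
        exact add_mem hx' hy'
      zero_mem' := ⟨zero_mem _, by
        rw [show g.hom ⟨0, _⟩ = _ from g.hom.map_zero]
        exact zero_mem _⟩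
      smul_mem' := by
        rintro a x ⟨hx, hx'⟩
        refine ⟨g.dom.mul_mem_left a hx, ?_⟩
        rw [show g.hom ⟨a • x, _⟩ = _ from hom_smul g a hx]
        exact f.dom.mul_mem_left a hx' }
  dense := fun a h => dense_mul f.dense g.dense a fun d hd e he =>
    h (d * e) ⟨g.dom.mul_mem_left d he, by
      rw [hom_smul g d he]
      exact f.dom.mul_mem_right _ hd⟩
  hom :=
    { toFun := fun x => f.hom ⟨g.hom ⟨x.1, x.2.1⟩, x.2.2⟩
      map_add' := by
        rintro ⟨x, hx, hx'⟩ ⟨y, hy, hy'⟩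
        rw [← map_add]
        congr 1
        exact Subtype.ext (g.hom.map_add ⟨x, hx⟩ ⟨y, hy⟩)
      map_smul' := by
        rintro a ⟨x, hx, hx'⟩
        rw [RingHom.id_apply, ← map_smul]
        congr 1
        exact Subtype.ext (hom_smul g a hx) }

theorem comp_mem (f g : DenseHom A) {d e : A} (hd : d ∈ f.dom) (he : e ∈ g.dom) :
    d * e ∈ (comp f g).dom :=
  ⟨g.dom.mul_mem_left d he, by
    rw [hom_smul g d he]
    exact f.dom.mul_mem_right _ hd⟩

theorem comp_mem' (f g : DenseHom A) {d e : A} (hd : d ∈ f.dom) (he : e ∈ g.dom) :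
    e * d ∈ (comp f g).dom := by
  rw [mul_comm]
  exact comp_mem f g hd he

/-- On a product the composition is the product of the values. -/
theorem comp_apply (f g : DenseHom A) {d e : A} (hd : d ∈ f.dom) (he : e ∈ g.dom)
    (h : d * e ∈ (comp f g).dom) :
    (comp f g).hom ⟨d * e, h⟩ = f.hom ⟨d, hd⟩ * g.hom ⟨e, he⟩ := by
  change f.hom ⟨g.hom ⟨d * e, _⟩, _⟩ = _
  rw [mul_comm (f.hom _), ← hom_smul f _ hd]
  congr 2
  rw [hom_smul g d he, mul_comm]

theorem comp_comm (f g : DenseHom A) : Rel (comp f g) (comp g f) :=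
  Rel.of_mul f.dense g.dense fun d hd e he =>
    ⟨comp_mem f g hd he, comp_mem' g f he hd, by
      rw [comp_apply f g hd he, mul_comm, ← comp_apply g f he hd (comp_mem g f he hd)]
      congr 2
      exact mul_comm e d⟩

theorem comp_congr_left {f f' : DenseHom A} (g : DenseHom A) (h : Rel f f') :
    Rel (comp f g) (comp f' g) := by
  rintro x ⟨hx, hx1⟩ ⟨_, hx2⟩
  exact h _ hx1 hx2

theorem comp_congr_right (f : DenseHom A) {g g' : DenseHom A} (h : Rel g g') :
    Rel (comp f g) (comp f g') := by
  rintro x ⟨hx, hx1⟩ ⟨hx', hx2⟩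
  change f.hom ⟨g.hom ⟨x, _⟩, _⟩ = f.hom ⟨g'.hom ⟨x, _⟩, _⟩
  congr 2
  exact h _ _ _

end DenseHom

/-- The maximal ring of quotients of `A`: the direct limit of the modules `Hom (D, A)` over all
dense ideals `D`, where homomorphisms are multiplied by composition. -/
def MaxQuotientRing (A : Type u) [CommRing A] : Type u := Quotient (DenseHom.setoid A)

namespace MaxQuotientRing

variable {A : Type u} [CommRing A]

instance : Zero (MaxQuotientRing A) := ⟨⟦DenseHom.ofElem 0⟧⟩

instance : One (MaxQuotientRing A) := ⟨⟦DenseHom.ofElem 1⟧⟩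

instance : Add (MaxQuotientRing A) :=
  ⟨Quotient.map₂ DenseHom.add fun _ _ hf _ _ hg x h h' =>
    congrArg₂ (· + ·) (hf x h.1 h'.1) (hg x h.2 h'.2)⟩

instance : Neg (MaxQuotientRing A) :=
  ⟨Quotient.map DenseHom.neg fun _ _ hf x h h' => congrArg Neg.neg (hf x h h')⟩

instance : Mul (MaxQuotientRing A) :=
  ⟨Quotient.map₂ DenseHom.comp fun _ f' hf g _ hg =>
    (DenseHom.setoid A).trans (DenseHom.comp_congr_left g hf) (DenseHom.comp_congr_right f' hg)⟩

theorem mul_comm' (p q : MaxQuotientRing A) : p * q = q * p := by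
  induction p, q using Quotient.inductionOn₂ with
  | _ f g => exact Quotient.sound (DenseHom.comp_comm f g)

theorem mul_add' (p q r : MaxQuotientRing A) : p * (q + r) = p * q + p * r := by
  induction p, q, r using Quotient.inductionOn₃ with
  | _ f g k =>
    refine Quotient.sound fun x hx hy => ?_
    obtain ⟨h, h'⟩ := hx
    obtain ⟨⟨h1, h1'⟩, ⟨h2, h2'⟩⟩ := hy
    exact f.hom.map_add ⟨_, h1'⟩ ⟨_, h2'⟩

theorem one_mul' (p : MaxQuotientRing A) : 1 * p = p := by
  induction p using Quotient.inductionOn with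
  | _ f => exact Quotient.sound fun x _ hy => one_mul (f.hom ⟨x, hy⟩)

instance : CommRing (MaxQuotientRing A) where
  add_assoc p q r := by
    induction p, q, r using Quotient.inductionOn₃ with
    | _ f g k => exact Quotient.sound fun x _ _ => add_assoc _ _ _
  zero_add p := by
    induction p using Quotient.inductionOn with
    | _ f =>
      refine Quotient.sound fun x _ hy => ?_
      change 0 * x + f.hom ⟨x, hy⟩ = f.hom ⟨x, hy⟩
      rw [zero_mul, zero_add]
  add_zero p := by
    induction p using Quotient.inductionOn with
    | _ f =>
      refine Quotient.sound fun x _ hy => ?_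
      change f.hom ⟨x, hy⟩ + 0 * x = f.hom ⟨x, hy⟩
      rw [zero_mul, add_zero]
  add_comm p q := by
    induction p, q using Quotient.inductionOn₂ with
    | _ f g => exact Quotient.sound fun x _ _ => add_comm _ _
  neg_add_cancel p := by
    induction p using Quotient.inductionOn with
    | _ f =>
      refine Quotient.sound fun x hx _ => ?_
      change -f.hom ⟨x, hx.1⟩ + f.hom ⟨x, hx.2⟩ = 0 * x
      rw [zero_mul, neg_add_cancel]
  mul_assoc p q r := by
    induction p, q, r using Quotient.inductionOn₃ with
    | _ f g k => exact Quotient.sound fun x _ _ => rfl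
  mul_comm := mul_comm'
  left_distrib := mul_add'
  right_distrib p q r := by rw [mul_comm', mul_add', mul_comm' r, mul_comm' r]
  one_mul := one_mul'
  mul_one p := by rw [mul_comm', one_mul']
  zero_mul p := by
    induction p using Quotient.inductionOn with
    | _ f =>
      refine Quotient.sound fun x hx hy => ?_
      change 0 * f.hom ⟨x, hx.1⟩ = 0 * x
      rw [zero_mul, zero_mul]
  mul_zero p := by
    rw [mul_comm']
    induction p using Quotient.inductionOn with
    | _ f =>
      refine Quotient.sound fun x hx hy => ?_
      change 0 * f.hom ⟨x, hx.1⟩ = 0 * x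
      rw [zero_mul, zero_mul]
  nsmul := nsmulRec
  zsmul := zsmulRec

/-- The canonical homomorphism of `A` into its maximal ring of quotients. -/
def of (A : Type u) [CommRing A] : A →+* MaxQuotientRing A where
  toFun a := ⟦DenseHom.ofElem a⟧
  map_one' := rfl
  map_mul' a b := Quotient.sound fun x _ _ => mul_assoc a b x
  map_zero' := rfl
  map_add' a b := Quotient.sound fun x _ _ => add_mul a b x

end MaxQuotientRing

/-! ### Boolean rings -/

/-- The Boolean ring of all idempotents of `A`: the multiplication is that of `A`, and the sum of
`e` and `f` is `e + f - 2 * e * f` (the symmetric difference in the Boolean algebra of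
idempotents). -/
abbrev IdempotentRing (A : Type u) [CommRing A] : Type u := AsBoolRing {e : A // IsIdempotentElem e}

/-- The free Boolean algebra, regarded as a Boolean ring, with free generators indexed by `ι`: the
free commutative ring modulo the identities `p * p = p`. -/
abbrev FreeBooleanRing (ι : Type u) : Type u :=
  FreeCommRing ι ⧸ Ideal.span (Set.range fun p : FreeCommRing ι => p * p - p)

/-- The Boolean algebra of all regular open subsets of `X`, regarded as a Boolean ring. -/
abbrev RegularOpenRing (X : Type u) [TopologicalSpace X] : Type u :=
  AsBoolRing (Heyting.Regular (Opens X))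

/-- A homomorphism `j : B → C` of Boolean rings is a completion of `B` if it is injective, `C` is
complete with respect to the order given by `a ≤ b ↔ a * b = a`, and the image of `B` is
order-dense in `C`. -/
structure IsBooleanCompletion {B : Type u} {C : Type v} [CommRing B] [CommRing C]
    (j : B →+* C) : Prop where
  injective : Function.Injective j
  idempotent : ∀ c : C, c * c = c
  exists_sup : ∀ S : Set C, ∃ s : C, (∀ a ∈ S, a * s = a) ∧
    ∀ t : C, (∀ a ∈ S, a * t = a) → s * t = s
  dense : ∀ c : C, c ≠ 0 → ∃ b : B, b ≠ 0 ∧ j b * c = j b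

/-! ### The ring `Q(X)` and the space `K` -/

/-- The maximal ring of quotients `Q(X)` of the ring of all continuous real-valued functions. -/
abbrev QRing (X : Type u) [TopologicalSpace X] : Type u := MaxQuotientRing C(X, ℝ)

/-- The continuous extension `βS → βT` of the inclusion of `S` in `T`. -/
noncomputable def stoneCechInclusion {Y : Type u} [TopologicalSpace Y] {S T : Set Y}
    (h : S ⊆ T) : StoneCech S → StoneCech T :=
  stoneCechExtend (continuous_stoneCechUnit.comp (continuous_inclusion h))

/-- The inverse limit of the spaces `βS`, where `S` ranges over the dense `G_δ` subsets of `βX`. -/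
def KSpace (X : Type u) [TopologicalSpace X] : Type u :=
  {x : (S : {S : Set (StoneCech X) // IsGδ S ∧ Dense S}) → StoneCech S.1 //
    ∀ (S T : {S : Set (StoneCech X) // IsGδ S ∧ Dense S}) (h : S.1 ⊆ T.1),
      stoneCechInclusion h (x S) = x T}

instance (X : Type u) [TopologicalSpace X] : TopologicalSpace (KSpace X) :=
  inferInstanceAs (TopologicalSpace (Subtype _))

/-! A complete Boolean ring is recovered from any dense family once it is known which members are
disjoint (`exists_ringEquiv_of_dense`): an element is determined by the members below it, and is
rebuilt elsewhere as the supremum of their counterparts. Three comparisons rest on this. Idempotents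
of `Q(X)` and regular open sets of `X` share the nonzero functions as index set, through supports
and cozero sets, disjointness meaning that the product vanishes. `X` and `βX` share the nonempty
open subsets of `βX`. Finally, a complete atomless Boolean ring with a countable dense set contains
a dense binary tree of partitions; the minterms of `B_∞` form another, and in such a tree two
members are disjoint exactly when their nodes are incomparable.

For a reduced ring, extending a homomorphism from an ideal by zero on the annihilator
(`exists_of_graph`) shows that the maximal ring of quotients is von Neumann regular with a complete
Boolean ring of idempotents. So `𝒬(B_∞)` is the completion of `B_∞`, and the maximal ideals of
`Q(X)` are those of its idempotents.

A maximal ideal of regular open subsets of `βX` is complementary to an ultrafilter, which converges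
in `βS` for every dense `S`; its limits form a point of `K(X)`. This map is a continuous bijection
from a compact to a Hausdorff space: dense open sets separate ultrafilters, and by Baire's theorem
the neighbourhoods of a point of `K(X)` generate a filter. Extremal disconnectedness is completeness
of the regular open sets. -/

/-! ### Complete Boolean rings and dense families -/

/-- Every set has a supremum for the order `a ≤ b ↔ a * b = a`. -/
def HasBooleanSups (C : Type*) [CommRing C] : Prop :=
  ∀ S : Set C, ∃ s : C, (∀ a ∈ S, a * s = a) ∧ ∀ t : C, (∀ a ∈ S, a * t = a) → s * t = s

/-- A family of nonzero elements such that every nonzero element dominates a member of it. -/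
structure IsDenseFamily {P C : Type*} [CommRing C] (j : P → C) : Prop where
  ne_zero : ∀ p, j p ≠ 0
  exists_le : ∀ c : C, c ≠ 0 → ∃ p, j p * c = j p

section Boolean

variable {P C C' : Type*} [CommRing C] [CommRing C']

theorem add_self_of_idem (hC : ∀ c : C, c * c = c) (a : C) : a + a = 0 := by
  have h := hC (a + a)
  rw [add_mul, mul_add, hC] at h
  simpa using h

/-- The complement is multiplicatively determined: it is the largest element disjoint from `a`. -/
theorem map_one_sub_of_idem (hC : ∀ c : C, c * c = c) (hC' : ∀ c : C', c * c = c) (f : C ≃* C')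
    (a : C) : f (1 - a) = 1 - f a := by
  have h1 : f a * f (1 - a) = 0 := by
    rw [← map_mul, mul_sub, mul_one, hC, sub_self, map_zero]
  have h2 : a * f.symm (1 - f a) = 0 := f.injective <| by
    rw [map_mul, f.apply_symm_apply, map_zero, mul_sub, mul_one, hC', sub_self]
  have h3 : f.symm (1 - f a) * (1 - a) = f.symm (1 - f a) := by
    linear_combination -h2
  have h4 := congrArg f h3
  rw [map_mul, f.apply_symm_apply] at h4
  linear_combination h4 + h1

/-- The symmetric difference, written with products and complements only, so that multiplicative
equivalences preserve it. -/
theorem add_eq_mul_of_idem (hC : ∀ c : C, c * c = c) (a b : C) :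
    a + b = (1 - (1 - a) * (1 - b)) * (1 - a * b) := by
  linear_combination (b - b * b) * hC a + a * b * add_self_of_idem hC 1

theorem mul_mul_eq_self_iff_of_idem (hC : ∀ c : C, c * c = c) (x a b : C) :
    x * (a * b) = x ↔ x * a = x ∧ x * b = x := by
  refine ⟨fun h => ⟨?_, ?_⟩, fun h => by rw [← mul_assoc, h.1, h.2]⟩
  · rw [← h]
    linear_combination x * b * hC a
  · rw [← h]
    linear_combination x * a * hC b

/-- A multiplicative equivalence of Boolean rings is additive. -/
def MulEquiv.toRingEquivOfIdem (hC : ∀ c : C, c * c = c) (hC' : ∀ c : C', c * c = c)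
    (f : C ≃* C') : C ≃+* C' :=
  { f with
    map_add' := fun a b => by
      change f (a + b) = f a + f b
      rw [add_eq_mul_of_idem hC a b, add_eq_mul_of_idem hC' (f a) (f b)]
      simp only [map_mul, map_one_sub_of_idem hC hC' f] }

theorem IsDenseFamily.exists_not_le (hC : ∀ c : C, c * c = c) {j : P → C} (hj : IsDenseFamily j)
    {a b : C} (h : a * b ≠ a) : ∃ p, j p * a = j p ∧ j p * b = 0 := by
  obtain ⟨p, hp⟩ := hj.exists_le (a * (1 - b)) fun h0 => h (by linear_combination -h0)
  refine ⟨p, ?_, ?_⟩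
  · rw [← hp]
    linear_combination j p * (1 - b) * hC a
  · rw [← hp]
    linear_combination -j p * a * hC b

theorem IsDenseFamily.ext (hC : ∀ c : C, c * c = c) {j : P → C} (hj : IsDenseFamily j)
    {a b : C} (h : ∀ p, j p * a = j p ↔ j p * b = j p) : a = b := by
  have key : ∀ a b : C, (∀ p, j p * a = j p → j p * b = j p) → a * b = a := fun a b h => by
    by_contra hab
    obtain ⟨p, h1, h2⟩ := hj.exists_not_le hC hab
    exact hj.ne_zero p (by rw [← h p h1, h2])
  rw [← key a b fun p => (h p).1, mul_comm, key b a fun p => (h p).2]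

/-- Take the supremum of the images of all members below `c`. If `p` is not below `c`, some `q`
below `p` is disjoint from `c`; then `j' q` is disjoint from that supremum, so `j' p` cannot lie
below it. -/
theorem IsDenseFamily.exists_transfer (hC : ∀ c : C, c * c = c)
    (sC' : HasBooleanSups C') {j : P → C} {j' : P → C'} (hj : IsDenseFamily j)
    (h : ∀ p q, j p * j q = 0 ↔ j' p * j' q = 0) (c : C) :
    ∃ c' : C', ∀ p, j' p * c' = j' p ↔ j p * c = j p := by
  obtain ⟨s, hs, hs'⟩ := sC' (j' '' {p | j p * c = j p})
  refine ⟨s, fun p => ⟨fun hp => ?_, fun hp => hs _ ⟨p, hp, rfl⟩⟩⟩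
  by_contra hpc
  obtain ⟨q, h1, h2⟩ := hj.exists_not_le hC hpc
  have h3 : s * j' q = 0 := by
    -- The complement of `j' q` is an upper bound of the set, hence lies above the supremum.
    have := hs' (1 - j' q) (by
      rintro _ ⟨r, hr, rfl⟩
      have : j' r * j' q = 0 := (h r q).1 (by
        rw [← show j r * c = j r from hr]
        linear_combination j r * h2)
      linear_combination -this)
    linear_combination -this
  have h4 : j' q * j' p = 0 := by
    rw [← hp]
    linear_combination j' p * h3
  exact hj.ne_zero q (by rw [← h1, (h q p).2 h4])

/-- A complete Boolean ring is determined by the disjointness relation on a dense family. -/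
theorem exists_ringEquiv_of_dense (hC : ∀ c : C, c * c = c) (hC' : ∀ c : C', c * c = c)
    (sC : HasBooleanSups C) (sC' : HasBooleanSups C') {j : P → C} {j' : P → C'}
    (hj : IsDenseFamily j) (hj' : IsDenseFamily j')
    (h : ∀ p q, j p * j q = 0 ↔ j' p * j' q = 0) : Nonempty (C ≃+* C') := by
  choose f hf using hj.exists_transfer hC sC' h
  choose g hg using hj'.exists_transfer hC' sC fun p q => (h p q).symm
  exact ⟨MulEquiv.toRingEquivOfIdem hC hC'
    { toFun := f
      invFun := g
      left_inv := fun c => hj.ext hC fun p => (hg _ p).trans (hf c p)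
      right_inv := fun c => hj'.ext hC' fun p => (hf _ p).trans (hg c p)
      map_mul' := fun a b => hj'.ext hC' fun p => by
        rw [hf, mul_mul_eq_self_iff_of_idem hC, mul_mul_eq_self_iff_of_idem hC',
          hf, hf] }⟩

end Boolean

/-! ### Binary trees of partitions -/

/-- A binary tree of nonzero elements such that every member is the disjoint sum of its two
successors. -/
structure IsPartitionTree {C : Type*} [CommRing C] (c : List Bool → C) : Prop where
  nil : c [] = 1
  add : ∀ s, c (true :: s) + c (false :: s) = c s
  mul : ∀ s, c (true :: s) * c (false :: s) = 0
  ne_zero : ∀ s, c s ≠ 0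

/-- The latest choice stands at the head of a word, so ancestors in the tree are suffixes;
incomparable words part at a common suffix `u`. -/
theorem List.isSuffix_or_branch (s t : List Bool) :
    s <:+ t ∨ t <:+ s ∨ ∃ u b, (b :: u) <:+ s ∧ ((!b) :: u) <:+ t := by
  induction s with
  | nil => exact Or.inl List.nil_suffix
  | cons a s ih =>
    rcases ih with ⟨w, rfl⟩ | h | ⟨u, b, h1, h2⟩
    · rcases List.eq_nil_or_concat w with rfl | ⟨w, b, rfl⟩
      · exact Or.inr (Or.inl (by simp))
      · by_cases hab : b = a
        · exact Or.inl ⟨w, by simp [hab]⟩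
        · refine Or.inr (Or.inr ⟨s, a, List.suffix_rfl, ⟨w, ?_⟩⟩)
          have : (!a) = b := by cases a <;> cases b <;> simp_all
          simp [this]
    · exact Or.inr (Or.inl (h.trans (List.suffix_cons a s)))
    · exact Or.inr (Or.inr ⟨u, b, h1.trans (List.suffix_cons a s), h2⟩)

namespace IsPartitionTree

variable {C : Type*} [CommRing C] {c : List Bool → C}

theorem mul_of_suffix (hC : ∀ x : C, x * x = x) (hc : IsPartitionTree c) {s t : List Bool}
    (h : s <:+ t) : c t * c s = c t := by
  obtain ⟨w, rfl⟩ := h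
  induction w with
  | nil => exact hC _
  | cons b w ih =>
    have h1 : c (b :: (w ++ s)) * c (w ++ s) = c (b :: (w ++ s)) := by
      have h2 := hc.mul (w ++ s)
      rw [← hc.add (w ++ s)]
      cases b
      · linear_combination h2 + hC (c (false :: (w ++ s)))
      · linear_combination h2 + hC (c (true :: (w ++ s)))
    rw [List.cons_append, ← h1, mul_assoc, ih]

/-- Disjointness depends on the words alone, so any two partition trees have the same disjointness
relation. -/
theorem mul_eq_zero_iff (hC : ∀ x : C, x * x = x) (hc : IsPartitionTree c) (s t : List Bool) :
    c s * c t = 0 ↔ ¬ (s <:+ t ∨ t <:+ s) := by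
  constructor
  · rintro h (h1 | h1)
    · exact hc.ne_zero t (by rw [← hc.mul_of_suffix hC h1, mul_comm, h])
    · exact hc.ne_zero s (by rw [← hc.mul_of_suffix hC h1, h])
  · intro h
    rcases List.isSuffix_or_branch s t with h1 | h1 | ⟨u, b, h1, h2⟩
    · exact absurd (Or.inl h1) h
    · exact absurd (Or.inr h1) h
    · rw [← hc.mul_of_suffix hC h1, ← hc.mul_of_suffix hC h2]
      have : c (b :: u) * c ((!b) :: u) = 0 := by
        cases b
        · rw [mul_comm]
          exact hc.mul u
        · exact hc.mul u
      linear_combination c s * c t * this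

/-- The elements of one level add up to `1`, so they cannot all annihilate `x`. -/
theorem exists_length_eq (hc : IsPartitionTree c) (n : ℕ) {x : C} (hx : x ≠ 0) :
    ∃ s : List Bool, s.length = n ∧ c s * x ≠ 0 := by
  induction n with
  | zero => exact ⟨[], rfl, by rwa [hc.nil, one_mul]⟩
  | succ n ih =>
    obtain ⟨s, rfl, hs⟩ := ih
    by_contra! h
    refine hs ?_
    rw [← hc.add, add_mul, h (true :: s) rfl, h (false :: s) rfl, add_zero]

end IsPartitionTree

/-- Splitting the elements of level `n` by `y n`. -/
def partitionTree {C : Type*} [CommRing C] (y : ℕ → C → C) : List Bool → C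
  | [] => 1
  | true :: s => y s.length (partitionTree y s)
  | false :: s => partitionTree y s - y s.length (partitionTree y s)

/-- An atomless Boolean ring with a countable dense set has a dense partition tree. -/
theorem exists_isPartitionTree_dense {C : Type*} [CommRing C] [Nontrivial C]
    (hC : ∀ x : C, x * x = x) (atomless : ∀ x : C, x ≠ 0 → ∃ y, y * x = y ∧ y ≠ 0 ∧ y ≠ x)
    (d : ℕ → C) (hd : ∀ x : C, x ≠ 0 → ∃ n, d n ≠ 0 ∧ d n * x = d n) :
    ∃ c : List Bool → C, IsPartitionTree c ∧ IsDenseFamily c := by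
  -- Cut `x` along `d n` when that cuts it properly; otherwise `d n` already decides `x`, and
  -- atomlessness provides an arbitrary cut.
  have split : ∀ (n : ℕ) (x : C), ∃ y, x ≠ 0 →
      y * x = y ∧ y ≠ 0 ∧ y ≠ x ∧ (y * d n = y ∨ x * d n = x ∨ x * d n = 0) := by
    intro n x
    by_cases hx : x = 0
    · exact ⟨0, fun h => absurd hx h⟩
    by_cases h1 : x * d n = 0 ∨ x * d n = x
    · obtain ⟨y, hy⟩ := atomless x hx
      exact ⟨y, fun _ => ⟨hy.1, hy.2.1, hy.2.2, Or.inr h1.symm⟩⟩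
    · rw [not_or] at h1
      exact ⟨x * d n, fun _ => ⟨by linear_combination d n * hC x, h1.1, h1.2,
        Or.inl (by linear_combination x * hC (d n))⟩⟩
  choose y hy using split
  have hne : ∀ s, partitionTree y s ≠ 0 := by
    intro s
    induction s with
    | nil => exact one_ne_zero
    | cons b s ih =>
      cases b
      · exact fun h => (hy s.length _ ih).2.2.1 (sub_eq_zero.1 h).symm
      · exact (hy s.length _ ih).2.1
  have ht : IsPartitionTree (partitionTree y) :=
    { nil := rfl
      add := fun s => add_sub_cancel _ _
      mul := fun s => by
        change y _ _ * (_ - y _ _) = 0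
        rw [mul_sub, (hy s.length _ (hne s)).1, hC, sub_self]
      ne_zero := hne }
  refine ⟨_, ht, hne, fun x hx => ?_⟩
  obtain ⟨n, hn, hnx⟩ := hd x hx
  -- A node of level `n` that meets `d n` excludes the last alternative of the splitting, so the
  -- node or its `true` child lies below `d n`, hence below `x`.
  obtain ⟨s, rfl, hs⟩ := ht.exists_length_eq n hn
  have key : ∀ z, z * d s.length = z → z * x = z := fun z hz => by
    rw [← hz, mul_assoc, hnx]
  rcases (hy s.length _ (hne s)).2.2.2 with h | h | h
  · exact ⟨true :: s, key _ h⟩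
  · exact ⟨s, key _ h⟩
  · exact absurd h hs

/-! ### The free Boolean ring -/

namespace FreeBooleanRing

theorem mul_self' {ι : Type u} (x : FreeBooleanRing ι) : x * x = x := by
  obtain ⟨p, rfl⟩ := Ideal.Quotient.mk_surjective x
  rw [← map_mul]
  exact Ideal.Quotient.eq.2 (Ideal.subset_span ⟨p, rfl⟩)

/-- The free generators. -/
noncomputable def gen {ι : Type u} (i : ι) : FreeBooleanRing ι := Ideal.Quotient.mk _ (FreeCommRing.of i)

/-- The homomorphism determined by the values of the generators. -/
noncomputable def lift {ι : Type u} {D : Type v} [CommRing D] (hD : ∀ x : D, x * x = x) (f : ι → D) :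
    FreeBooleanRing ι →+* D :=
  Ideal.Quotient.lift _ (FreeCommRing.lift f) <| by
    change ∀ a ∈ _, a ∈ RingHom.ker (FreeCommRing.lift f)
    refine fun a ha => (Ideal.span_le.2 ?_ : _ ≤ RingHom.ker (FreeCommRing.lift f)) ha
    rintro _ ⟨p, rfl⟩
    change FreeCommRing.lift f (p * p - p) = 0
    rw [map_sub, map_mul, hD, sub_self]

theorem lift_gen {ι : Type u} {D : Type v} [CommRing D] (hD : ∀ x : D, x * x = x) (f : ι → D)
    (i : ι) : lift hD f (gen i) = f i :=
  FreeCommRing.lift_of f i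

/-- The minimal elements of the subalgebras generated by the first generators. -/
noncomputable abbrev minterm : List Bool → FreeBooleanRing ℕ := partitionTree fun n x => x * gen n

/-- The word is a truth assignment to the first generators that satisfies its minterm. Later values
stay free so that the induction can prescribe one more. -/
theorem exists_lift_minterm (s : List Bool) : ∃ f : ℕ → ZMod 2, ∀ f' : ℕ → ZMod 2,
    (∀ i < s.length, f' i = f i) → lift (by decide) f' (minterm s) = 1 := by
  induction s with
  | nil => exact ⟨0, fun f' _ => map_one _⟩
  | cons b s ih =>
    obtain ⟨f, hf⟩ := ih
    refine ⟨Function.update f s.length (if b then 1 else 0), fun f' h => ?_⟩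
    have h1 := hf f' fun i hi => by
      rw [h i (by simp; omega), Function.update_of_ne hi.ne]
    have h2 := h s.length (by simp)
    rw [Function.update_self] at h2
    cases b
    · change lift _ f' (minterm s - minterm s * gen s.length) = 1
      rw [map_sub, map_mul, h1, lift_gen, h2]
      simp
    · change lift _ f' (minterm s * gen s.length) = 1
      rw [map_mul, h1, lift_gen, h2]
      simp

theorem isPartitionTree_minterm : IsPartitionTree minterm where
  nil := rfl
  add s := add_sub_cancel _ _
  mul s := by
    change (minterm s * gen _) * (minterm s - minterm s * gen _) = 0
    linear_combination (-minterm s * minterm s) * mul_self' (gen s.length)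
  ne_zero s h := by
    obtain ⟨f, hf⟩ := exists_lift_minterm s
    have := hf f fun _ _ => rfl
    rw [h, map_zero] at this
    exact zero_ne_one this

theorem minterm_mul_gen (i : ℕ) (s : List Bool) (hs : i < s.length) :
    minterm s * gen i = 0 ∨ minterm s * gen i = minterm s := by
  induction s with
  | nil => simp at hs
  | cons b s ih =>
    rcases (Nat.lt_succ_iff.1 (by simpa using hs)).lt_or_eq with h | rfl
    · rw [← isPartitionTree_minterm.mul_of_suffix mul_self' (List.suffix_cons b s)]
      rcases ih h with h | h
      · left
        rw [mul_assoc, h, mul_zero]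
      · right
        rw [mul_assoc, h]
    · cases b
      · left
        change (minterm s - minterm s * gen _) * gen _ = 0
        linear_combination -minterm s * mul_self' (gen s.length)
      · right
        change (minterm s * gen _) * gen _ = minterm s * gen _
        linear_combination minterm s * mul_self' (gen s.length)

/-- An element involves finitely many generators, and a minterm long enough to decide them all
decides the element. -/
theorem exists_minterm_mul (x : FreeBooleanRing ℕ) :
    ∃ n, ∀ s : List Bool, n ≤ s.length → minterm s * x = 0 ∨ minterm s * x = minterm s := by
  obtain ⟨p, rfl⟩ := Ideal.Quotient.mk_surjective x
  induction p using FreeCommRing.induction_on with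
  | neg_one =>
    refine ⟨0, fun s _ => Or.inr ?_⟩
    rw [map_neg, map_one]
    linear_combination -add_self_of_idem mul_self' (minterm s)
  | of i => exact ⟨i + 1, fun s hs => minterm_mul_gen i s hs⟩
  | add p q hp hq =>
    obtain ⟨m, hm⟩ := hp
    obtain ⟨n, hn⟩ := hq
    refine ⟨max m n, fun s hs => ?_⟩
    rw [map_add, mul_add]
    rcases hm s (le_of_max_le_left hs) with h1 | h1 <;>
    rcases hn s (le_of_max_le_right hs) with h2 | h2 <;> rw [h1, h2]
    · simp
    · simp
    · simp
    · exact Or.inl (add_self_of_idem mul_self' _)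
  | mul p q hp hq =>
    obtain ⟨m, hm⟩ := hp
    obtain ⟨n, hn⟩ := hq
    refine ⟨max m n, fun s hs => ?_⟩
    rw [map_mul, ← mul_assoc]
    rcases hm s (le_of_max_le_left hs) with h1 | h1
    · left
      rw [h1, zero_mul]
    · rw [h1]
      exact hn s (le_of_max_le_right hs)

theorem isDenseFamily_minterm : IsDenseFamily minterm where
  ne_zero := isPartitionTree_minterm.ne_zero
  exists_le x hx := by
    obtain ⟨n, hn⟩ := exists_minterm_mul x
    obtain ⟨s, rfl, hs⟩ := isPartitionTree_minterm.exists_length_eq n hx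
    exact ⟨s, (hn s le_rfl).resolve_left hs⟩

end FreeBooleanRing

/-- A complete atomless Boolean ring with a countable dense set is the completion of the free
Boolean ring on countably many generators. -/
theorem exists_ringEquiv_completion_freeBooleanRing {C C' : Type*} [CommRing C] [CommRing C']
    [Nontrivial C] (hC : ∀ x : C, x * x = x) (sC : HasBooleanSups C)
    (atomless : ∀ x : C, x ≠ 0 → ∃ y, y * x = y ∧ y ≠ 0 ∧ y ≠ x)
    (d : ℕ → C) (hd : ∀ x : C, x ≠ 0 → ∃ n, d n ≠ 0 ∧ d n * x = d n)
    {j : FreeBooleanRing ℕ →+* C'} (hj : IsBooleanCompletion j) : Nonempty (C ≃+* C') := by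
  obtain ⟨c, hc, hcd⟩ := exists_isPartitionTree_dense hC atomless d hd
  have hm := FreeBooleanRing.isPartitionTree_minterm
  have hne : ∀ {x}, x ≠ 0 → j x ≠ 0 := fun h => (map_ne_zero_iff j hj.injective).2 h
  refine exists_ringEquiv_of_dense hC hj.idempotent sC hj.exists_sup hcd
    (j' := fun s => j (FreeBooleanRing.minterm s)) ⟨fun s => hne (hm.ne_zero s), fun x hx => ?_⟩
    fun s t => ?_
  · obtain ⟨b, hb, hbx⟩ := hj.dense x hx
    obtain ⟨s, hs⟩ := FreeBooleanRing.isDenseFamily_minterm.exists_le b hb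
    exact ⟨s, by rw [← hs, map_mul, mul_assoc, hbx]⟩
  · rw [hc.mul_eq_zero_iff hC, ← map_mul, map_eq_zero_iff j hj.injective,
      hm.mul_eq_zero_iff FreeBooleanRing.mul_self']

/-! ### The maximal ring of quotients of a reduced ring -/

namespace MaxQuotientRing

variable {A : Type u} [CommRing A]

theorem of_injective : Function.Injective (of A) := fun a b h => by
  have := Quotient.exact h (1 : A) trivial trivial
  change a * 1 = b * 1 at this
  simpa using this

/-- The class of a homomorphism defined on a dense ideal. -/
def mk (f : DenseHom A) : MaxQuotientRing A := Quotient.mk _ f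

theorem mk_mul_of (f : DenseHom A) {x : A} (hx : x ∈ f.dom) :
    mk f * of A x = of A (f.hom ⟨x, hx⟩) := by
  refine Quotient.sound fun y hy _ => ?_
  change f.hom ⟨x * y, _⟩ = f.hom ⟨x, hx⟩ * y
  rw [mul_comm (f.hom _), ← DenseHom.hom_smul f y hx]
  congr 2
  exact mul_comm x y

theorem exists_dense_mul_of (q : MaxQuotientRing A) :
    ∃ D : Ideal A, D.IsRationallyDense ∧ ∀ d ∈ D, ∃ a, q * of A d = of A a := by
  induction q using Quotient.inductionOn with
  | _ f => exact ⟨f.dom, f.dense, fun d hd => ⟨_, mk_mul_of f hd⟩⟩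

/-- The hypothesis says that the ideal of all `x` with `q * x = 0` is rationally dense. -/
theorem eq_zero_of_dense {q : MaxQuotientRing A}
    (h : ∀ a : A, (∀ x, q * of A x = 0 → a * x = 0) → a = 0) : q = 0 := by
  induction q using Quotient.inductionOn with
  | _ f =>
    refine Quotient.sound fun x hx _ => ?_
    change f.hom ⟨x, hx⟩ = 0 * x
    rw [zero_mul]
    refine h _ fun d hd => of_injective ?_
    rw [map_mul, ← mk_mul_of f hx, mul_right_comm, show mk f * of A d = 0 from hd, zero_mul, map_zero]

theorem exists_mul_of_ne_zero {q : MaxQuotientRing A} (hq : q ≠ 0) :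
    ∃ d a, a ≠ 0 ∧ q * of A d = of A a := by
  obtain ⟨D, hD, h⟩ := exists_dense_mul_of q
  by_contra! h0
  refine hq (eq_zero_of_dense fun a ha => hD a fun d hd => ha d ?_)
  obtain ⟨b, hb⟩ := h d hd
  by_contra h1
  refine h0 d b ?_ hb
  rintro rfl
  exact h1 (by rw [hb, map_zero])

/-- A nonzero idempotent fixes a nonzero element of the ring. -/
theorem exists_idem_mul_of {e : MaxQuotientRing A} (he : e * e = e) (h0 : e ≠ 0) :
    ∃ a, a ≠ 0 ∧ e * of A a = of A a := by
  obtain ⟨d, a, ha, h⟩ := exists_mul_of_ne_zero h0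
  exact ⟨a, ha, by rw [← h, ← mul_assoc, he]⟩

variable [IsReduced A]

theorem eq_zero_of_mul_self {a : A} (h : a * a = 0) : a = 0 :=
  IsReduced.eq_zero a ⟨2, by rw [sq, h]⟩

/-- The graph of a homomorphism from an ideal of a reduced ring defines an element of the maximal
ring of quotients, which is zero on the annihilator of that ideal. -/
theorem exists_of_graph (G : Submodule A (A × A)) (hG : ∀ p ∈ G, p.1 = 0 → p.2 = 0) :
    ∃ q : MaxQuotientRing A, (∀ p ∈ G, q * of A p.1 = of A p.2) ∧
      ∀ z, (∀ p ∈ G, z * p.1 = 0) → q * of A z = 0 := by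
  -- The zero map on the annihilator of the domain of `G`. In a reduced ring an ideal meets its
  -- annihilator only in `0`, so the sum is still a graph, and its domain is dense.
  let N : Submodule A (A × A) :=
    { carrier := {w | w.2 = 0 ∧ ∀ p ∈ G, w.1 * p.1 = 0}
      add_mem' := fun {v w} hv hw => ⟨by simp [hv.1, hw.1], fun p hp => by
        simp [add_mul, hv.2 p hp, hw.2 p hp]⟩
      zero_mem' := ⟨rfl, fun p _ => zero_mul _⟩
      smul_mem' := fun a w hw => ⟨by simp [hw.1], fun p hp => by
        simp [mul_assoc, hw.2 p hp]⟩ }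
  have hN : ∀ p ∈ G ⊔ N, p.1 = 0 → p.2 = 0 := by
    intro p hp h0
    obtain ⟨x, hx, w, hw, rfl⟩ := Submodule.mem_sup.1 hp
    have h1 : x.1 + w.1 = 0 := h0
    have h2 : x.1 = 0 := eq_zero_of_mul_self (by linear_combination x.1 * h1 - hw.2 x hx)
    change x.2 + w.2 = 0
    rw [hG x hx h2, hw.1, add_zero]
  let L := (G ⊔ N).toLinearPMap
  have hL : ∀ p ∈ G ⊔ N, ∃ h : p.1 ∈ L.domain, L.toFun ⟨p.1, h⟩ = p.2 := by
    intro p hp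
    have h1 : p ∈ L.graph := by
      rw [Submodule.toLinearPMap_graph_eq _ hN]
      exact hp
    obtain ⟨y, hy1, hy2⟩ := (LinearPMap.mem_graph_iff L).1 h1
    exact ⟨hy1 ▸ y.2, by rw [← hy2]; congr 1; exact Subtype.ext hy1.symm⟩
  let f : DenseHom A :=
    { dom := L.domain
      dense := fun a ha => by
        have h1 : ∀ p ∈ G, a * p.1 = 0 := fun p hp =>
          ha _ (hL p (Submodule.mem_sup_left hp)).1
        have h2 : ((a, 0) : A × A) ∈ N := ⟨rfl, h1⟩
        exact eq_zero_of_mul_self (ha _ (hL _ (Submodule.mem_sup_right h2)).1)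
      hom := L.toFun }
  have key : ∀ p ∈ G ⊔ N, mk f * of A p.1 = of A p.2 := by
    intro p hp
    obtain ⟨h1, h2⟩ := hL p hp
    rw [← h2]
    exact mk_mul_of f h1
  refine ⟨mk f, fun p hp => key p (Submodule.mem_sup_left hp), fun z hz => ?_⟩
  have h2 : ((z, 0) : A × A) ∈ N := ⟨rfl, hz⟩
  rw [key _ (Submodule.mem_sup_right h2), map_zero]

/-- The maximal ring of quotients of a reduced ring is von Neumann regular. -/
theorem exists_mul_mul_eq_self (q : MaxQuotientRing A) : ∃ r, q * r * q = q := by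
  -- The graph of the inverse of `q`, restricted to the annihilator of the kernel of `q`, where `q`
  -- is injective.
  let G : Submodule A (A × A) :=
    { carrier := {p | q * of A p.2 = of A p.1 ∧ ∀ k, q * of A k = 0 → p.2 * k = 0}
      add_mem' := fun {v w} hv hw => ⟨by simp [mul_add, hv.1, hw.1], fun k hk => by
        simp [add_mul, hv.2 k hk, hw.2 k hk]⟩
      zero_mem' := ⟨by simp, by simp⟩
      smul_mem' := fun a w hw => ⟨by simp [← hw.1, mul_left_comm], fun k hk => by
        simp [mul_assoc, hw.2 k hk]⟩ }
  obtain ⟨r, hr, -⟩ := exists_of_graph G fun p hp h0 =>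
    eq_zero_of_mul_self (hp.2 _ (by rw [hp.1, h0, map_zero]))
  refine ⟨r, sub_eq_zero.1 (eq_zero_of_dense fun a ha => ?_)⟩
  obtain ⟨D, hD, h⟩ := exists_dense_mul_of q
  refine hD a fun d hd => eq_zero_of_mul_self ?_
  obtain ⟨b, hb⟩ := h d hd
  have hab : ((a * b, a * d) : A × A) ∈ G := by
    refine ⟨by simp [← hb, mul_left_comm], fun k hk => ?_⟩
    have := ha k (by linear_combination (q * r - 1) * hk)
    linear_combination d * this
  have h1 := hr _ hab
  have h2 := ha (a * d) (by
    have h3 := hab.1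
    simp only at h1 h3
    linear_combination q * h1 + (q * r) * h3)
  linear_combination d * h2

theorem exists_sup_of_idempotents (S : Set (MaxQuotientRing A)) (hS : ∀ s ∈ S, s * s = s) :
    ∃ e : MaxQuotientRing A, e * e = e ∧ (∀ s ∈ S, s * e = s) ∧
      ∀ t, (∀ s ∈ S, s * t = s) → e * t = e := by
  -- The supremum is the identity on the ideal generated by the elements fixed by some `s ∈ S`, and
  -- zero on its annihilator.
  let I : Ideal A := Ideal.span {a | ∃ s ∈ S, s * of A a = of A a}
  obtain ⟨e, he, he'⟩ := exists_of_graph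
    (Submodule.map (LinearMap.prod LinearMap.id LinearMap.id) I) (by
      rintro _ ⟨x, _, rfl⟩ h
      exact h)
  replace he : ∀ x ∈ I, e * of A x = of A x := fun x hx => he _ ⟨x, hx, rfl⟩
  replace he' : ∀ z, (∀ x ∈ I, z * x = 0) → e * of A z = 0 := fun z hz =>
    he' z (by
      rintro _ ⟨x, hx, rfl⟩
      exact hz x hx)
  -- As `e` kills the annihilator of `I`, multiples of `e` are determined by their action on `I`.
  have key : ∀ p q : MaxQuotientRing A, (∀ x ∈ I, e * p * of A x = e * q * of A x) →
      e * p = e * q := fun p q h => by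
    refine sub_eq_zero.1 (eq_zero_of_dense fun a ha => ?_)
    have h1 : ∀ x ∈ I, a * x = 0 := fun x hx => ha x (by rw [sub_mul, h x hx, sub_self])
    exact eq_zero_of_mul_self (ha a (by linear_combination (p - q) * he' a h1))
  refine ⟨e, ?_, fun s hs => ?_, fun t ht => ?_⟩
  · rw [key e 1 fun x hx => by rw [mul_one, mul_assoc, he x hx, he x hx], mul_one]
  · obtain ⟨D, hD, h⟩ := exists_dense_mul_of s
    refine sub_eq_zero.1 (eq_zero_of_dense fun a ha => hD a fun d hd => ha d ?_)
    obtain ⟨b, hb⟩ := h d hd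
    have := he b (Ideal.subset_span ⟨s, hs, by rw [← hb, ← mul_assoc, hS s hs]⟩)
    rw [← hb] at this
    linear_combination this
  · rw [key t 1 fun x hx => ?_, mul_one]
    suffices h : t * of A x = of A x by rw [mul_one, mul_assoc, h]
    induction hx using Submodule.span_induction with
    | mem x hx =>
      obtain ⟨s, hs, hx⟩ := hx
      rw [← hx, ← mul_assoc, mul_comm t, ht s hs]
    | zero => rw [map_zero, mul_zero]
    | add x y _ _ hx hy => rw [map_add, mul_add, hx, hy]
    | smul a x _ hx => rw [smul_eq_mul, map_mul, mul_left_comm, hx]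

/-- The maximal ring of quotients of a Boolean ring is its completion. -/
theorem isBooleanCompletion_of {B : Type u} [CommRing B] (hB : ∀ b : B, b * b = b) :
    IsBooleanCompletion (of B) := by
  have : IsReduced B := (isReduced_iff_pow_one_lt 2 one_lt_two).2 fun x hx => by
    rwa [sq, hB] at hx
  have idem : ∀ q : MaxQuotientRing B, q * q = q := fun q => by
    obtain ⟨D, hD, h⟩ := exists_dense_mul_of q
    refine sub_eq_zero.1 (eq_zero_of_dense fun a ha => hD a fun d hd => ha d ?_)
    obtain ⟨b, hb⟩ := h d hd
    have h1 : of B d * of B d = of B d := by rw [← map_mul, hB]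
    have h2 : of B b * of B b = of B b := by rw [← map_mul, hB]
    rw [← hb] at h2
    linear_combination h2 - q * q * h1
  refine ⟨of_injective, idem, fun S => ?_, fun c hc => ?_⟩
  · obtain ⟨e, -, h⟩ := exists_sup_of_idempotents S fun s _ => idem s
    exact ⟨e, h⟩
  · obtain ⟨b, hb, h⟩ := exists_idem_mul_of (idem c) hc
    exact ⟨b, hb, by rw [mul_comm, h]⟩

end MaxQuotientRing

/-! ### The Boolean ring of idempotents -/

namespace IdempotentRing

variable {A : Type u} [CommRing A]

/-- The idempotent itself, as an element of the ring. -/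
def val (x : IdempotentRing A) : A := (ofBoolRing x).1

/-- An idempotent, as an element of the Boolean ring. -/
def ofIdem (e : A) (he : e * e = e) : IdempotentRing A := toBoolRing ⟨e, he⟩

theorem val_injective : Function.Injective (val (A := A)) := Subtype.val_injective

theorem val_mul_self (x : IdempotentRing A) : val x * val x = val x := (ofBoolRing x).2

theorem val_mul (x y : IdempotentRing A) : val (x * y) = val x * val y := rfl

theorem val_zero : val (0 : IdempotentRing A) = 0 := rfl

theorem val_one_add (x : IdempotentRing A) : val (1 + x) = 1 - val x := by
  change (ofBoolRing (1 + x)).1 = 1 - (ofBoolRing x).1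
  rw [ofBoolRing_add, ofBoolRing_one, top_symmDiff]
  rfl

theorem hasBooleanSups [IsReduced A] : HasBooleanSups (IdempotentRing (MaxQuotientRing A)) := by
  intro S
  obtain ⟨e, he, h1, h2⟩ := MaxQuotientRing.exists_sup_of_idempotents (val '' S) (by
    rintro _ ⟨s, -, rfl⟩
    exact val_mul_self s)
  refine ⟨ofIdem e he, fun s hs => val_injective (h1 _ ⟨s, hs, rfl⟩), fun t ht => ?_⟩
  refine val_injective (h2 (val t) ?_)
  rintro _ ⟨s, hs, rfl⟩
  rw [← val_mul, ht s hs]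

/-- The supports of the nonzero elements of a reduced ring form a dense family. -/
theorem exists_isDenseFamily [IsReduced A] :
    ∃ j : {a : A // a ≠ 0} → IdempotentRing (MaxQuotientRing A),
      IsDenseFamily j ∧ ∀ a b, j a * j b = 0 ↔ a.1 * b.1 = 0 := by
  choose r hr using MaxQuotientRing.exists_mul_mul_eq_self (A := A)
  let ι := MaxQuotientRing.of A
  let j : {a : A // a ≠ 0} → IdempotentRing (MaxQuotientRing A) := fun a =>
    ofIdem (ι a.1 * r (ι a.1)) (by linear_combination r (ι a.1) * hr (ι a.1))
  have hj : ∀ a b, j a * j b = 0 ↔ a.1 * b.1 = 0 := fun a b => by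
    rw [← val_injective.eq_iff, val_mul, val_zero]
    change ι a.1 * r (ι a.1) * (ι b.1 * r (ι b.1)) = 0 ↔ _
    constructor
    · intro h
      refine MaxQuotientRing.of_injective ?_
      change ι _ = ι _
      rw [map_mul, map_zero]
      linear_combination ι a.1 * ι b.1 * h - ι b.1 * hr (ι a.1) -
        ι a.1 * r (ι a.1) * ι a.1 * hr (ι b.1)
    · intro h
      have h1 : ι a.1 * ι b.1 = 0 := by rw [← map_mul, h, map_zero]
      linear_combination r (ι a.1) * r (ι b.1) * h1
  refine ⟨j, ⟨fun a h => a.2 (MaxQuotientRing.eq_zero_of_mul_self ?_), fun e he => ?_⟩, hj⟩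
  · rw [← hj a a, h, mul_zero]
  · obtain ⟨a, ha, h⟩ := MaxQuotientRing.exists_idem_mul_of (val_mul_self e)
      fun h => he (val_injective h)
    refine ⟨⟨a, ha⟩, val_injective ?_⟩
    change ι a * r (ι a) * val e = ι a * r (ι a)
    linear_combination r (ι a) * h

end IdempotentRing

theorem TopologicalSpace.Opens.ne_bot_of_mem {X : Type*} [TopologicalSpace X] {U : Opens X}
    {x : X} (hx : x ∈ U) : U ≠ ⊥ := by
  rintro rfl
  exact hx

/-! ### The Boolean ring of regular open sets -/

namespace RegularOpenRing

variable {X : Type u} [TopologicalSpace X]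

/-- The regular open set itself. -/
def val (c : RegularOpenRing X) : Opens X := (ofBoolRing c).val

/-- The regular open set generated by an open set. -/
def reg (U : Opens X) : RegularOpenRing X := toBoolRing (Heyting.Regular.toRegular U)

theorem val_injective : Function.Injective (val (X := X)) :=
  fun _ _ h => Heyting.Regular.coe_injective h

theorem val_zero : val (0 : RegularOpenRing X) = ⊥ := rfl

theorem val_mul (c d : RegularOpenRing X) : val (c * d) = val c ⊓ val d := rfl

theorem val_reg (U : Opens X) : val (reg U) = Uᶜᶜ := rfl

theorem reg_val (c : RegularOpenRing X) : reg (val c) = c := Heyting.Regular.toRegular_coe c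

theorem mul_eq_left {c d : RegularOpenRing X} : c * d = c ↔ val c ≤ val d := by
  rw [← val_injective.eq_iff, val_mul, inf_eq_left]

theorem reg_mul_eq_left {U : Opens X} {c : RegularOpenRing X} :
    reg U * c = reg U ↔ U ≤ val c :=
  mul_eq_left.trans (Heyting.Regular.gi.gc U (ofBoolRing c))

theorem reg_mul (U V : Opens X) : reg U * reg V = reg (U ⊓ V) :=
  val_injective (compl_compl_inf_distrib U V).symm

theorem reg_eq_zero {U : Opens X} : reg U = 0 ↔ U = ⊥ := by
  rw [← val_injective.eq_iff, val_reg, val_zero]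
  exact ⟨fun h => le_bot_iff.1 (le_compl_compl.trans h.le), by rintro rfl; simp⟩

/-- The supremum is the regularization of the union. -/
theorem hasBooleanSups : HasBooleanSups (RegularOpenRing X) := by
  intro S
  refine ⟨reg (sSup (val '' S)), fun a ha => ?_, fun t ht => ?_⟩
  · rw [mul_eq_left, val_reg]
    exact (le_sSup (Set.mem_image_of_mem _ ha)).trans le_compl_compl
  · rw [reg_mul_eq_left, sSup_le_iff]
    rintro _ ⟨a, ha, rfl⟩
    exact mul_eq_left.1 (ht a ha)

theorem mul_self' (c : RegularOpenRing X) : c * c = c := BooleanRing.mul_self c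

theorem isDenseFamily_reg {P : Type*} {j : P → Opens X} (h0 : ∀ p, j p ≠ ⊥)
    (h : ∀ U : Opens X, U ≠ ⊥ → ∃ p, j p ≤ U) : IsDenseFamily fun p => reg (j p) where
  ne_zero p := fun hp => h0 p (reg_eq_zero.1 hp)
  exists_le c hc := by
    obtain ⟨p, hp⟩ := h (val c) fun h => hc (val_injective h)
    exact ⟨p, reg_mul_eq_left.2 hp⟩

end RegularOpenRing

/-! ### Cozero sets, and comparison of regular open sets with `Q(X)` and `B_∞` -/

instance isReduced_continuousMap (X : Type u) [TopologicalSpace X] : IsReduced C(X, ℝ) :=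
  (isReduced_iff_pow_one_lt 2 one_lt_two).2 fun f hf => by
    ext x
    exact pow_eq_zero_iff two_ne_zero |>.1 (DFunLike.congr_fun hf x)

/-- The set of all points where a function does not vanish. -/
def cozeroOpens {X : Type u} [TopologicalSpace X] (a : C(X, ℝ)) : Opens X :=
  ⟨{x | a x ≠ 0}, isOpen_ne_fun a.continuous continuous_const⟩

theorem exists_cozeroOpens_le {X : Type u} [TopologicalSpace X] [CompletelyRegularSpace X]
    {U : Opens X} (hU : U ≠ ⊥) : ∃ a : C(X, ℝ), a ≠ 0 ∧ cozeroOpens a ≤ U := by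
  obtain ⟨x, hx⟩ := (Opens.ne_bot_iff_nonempty U).1 hU
  obtain ⟨f, hf, hfx, hfU⟩ := CompletelyRegularSpace.completely_regular x (U : Set X)ᶜ
    U.isOpen.isClosed_compl (fun h => h hx)
  refine ⟨⟨fun y => 1 - (f y : ℝ), by fun_prop⟩, fun h => ?_, fun y hy => ?_⟩
  · have := DFunLike.congr_fun h x
    simp [hfx] at this
  · by_contra hyU
    refine hy ?_
    have : f y = 1 := hfU hyU
    simp [this]

/-- The idempotents of `Q(X)` correspond to the regular open sets. -/
theorem exists_ringEquiv_idempotentRing (X : Type u) [TopologicalSpace X]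
    [CompletelyRegularSpace X] :
    Nonempty (IdempotentRing (QRing X) ≃+* RegularOpenRing X) := by
  obtain ⟨j, hj, hj0⟩ := IdempotentRing.exists_isDenseFamily (A := C(X, ℝ))
  refine exists_ringEquiv_of_dense (fun c => BooleanRing.mul_self c) RegularOpenRing.mul_self'
    IdempotentRing.hasBooleanSups RegularOpenRing.hasBooleanSups hj
    (RegularOpenRing.isDenseFamily_reg (j := fun a : {a : C(X, ℝ) // a ≠ 0} => cozeroOpens a.1)
      (fun a h => a.2 ?_) fun U hU => ?_) fun a b => ?_
  · ext x
    by_contra hx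
    have : x ∈ cozeroOpens a.1 := hx
    rw [h] at this
    exact this
  · obtain ⟨a, ha, h⟩ := exists_cozeroOpens_le hU
    exact ⟨⟨a, ha⟩, h⟩
  · rw [hj0, RegularOpenRing.reg_mul, RegularOpenRing.reg_eq_zero]
    constructor
    · refine fun h => Opens.ext (Set.eq_empty_of_forall_notMem fun x hx => ?_)
      have := DFunLike.congr_fun h x
      exact mul_ne_zero hx.1 hx.2 this
    · intro h
      ext x
      by_contra hx
      have : x ∈ cozeroOpens a.1 ⊓ cozeroOpens b.1 := mul_ne_zero_iff.1 hx
      rw [h] at this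
      exact this

/-- The regular open sets of a second countable space without isolated points form the
completion of the free Boolean ring. -/
theorem exists_ringEquiv_regularOpenRing_completion (X : Type u) [TopologicalSpace X] [T2Space X]
    [SecondCountableTopology X] [Nonempty X] (hX : ∀ x : X, ¬ IsOpen ({x} : Set X)) :
    Nonempty (RegularOpenRing X ≃+* MaxQuotientRing (FreeBooleanRing ℕ)) := by
  have hne : ∀ {c : RegularOpenRing X}, c ≠ 0 → ∃ x, x ∈ RegularOpenRing.val c := fun h =>
    (Opens.ne_bot_iff_nonempty _).1 fun h' => h (RegularOpenRing.val_injective h')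
  have : Nontrivial (RegularOpenRing X) := by
    refine ⟨RegularOpenRing.reg ⊤, 0, fun h => ?_⟩
    have h1 := RegularOpenRing.reg_eq_zero.1 h
    obtain ⟨x⟩ := ‹Nonempty X›
    have : x ∈ (⊤ : Opens X) := trivial
    rw [h1] at this
    exact this
  obtain ⟨b, hbc, hb0, hb⟩ := exists_countable_basis X
  have hbne : b.Nonempty := by
    obtain ⟨x⟩ := ‹Nonempty X›
    obtain ⟨v, hv, -⟩ := hb.exists_subset_of_mem_open (Set.mem_univ x) isOpen_univ
    exact ⟨v, hv⟩
  obtain ⟨e, rfl⟩ := hbc.exists_eq_range hbne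
  refine exists_ringEquiv_completion_freeBooleanRing RegularOpenRing.mul_self'
    RegularOpenRing.hasBooleanSups (fun c hc => ?_)
    (fun n => RegularOpenRing.reg ⟨e n, hb.isOpen ⟨n, rfl⟩⟩) (fun c hc => ?_)
    (MaxQuotientRing.isBooleanCompletion_of FreeBooleanRing.mul_self')
  · obtain ⟨x, hx⟩ := hne hc
    -- Without isolated points `c` has a second point `y`. Cutting `c` down to a neighbourhood of
    -- `y` that misses a neighbourhood of `x` gives a strictly smaller nonzero element.
    have : ∃ y ∈ RegularOpenRing.val c, y ≠ x := by
      by_contra! h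
      refine hX x ?_
      rw [← show (RegularOpenRing.val c : Set X) = {x} from
        Set.eq_singleton_iff_unique_mem.2 ⟨hx, h⟩]
      exact (RegularOpenRing.val c).isOpen
    obtain ⟨y, hy, hyx⟩ := this
    obtain ⟨U, V, hU, hV, hyU, hxV, hUV⟩ := t2_separation hyx
    have hU0 : RegularOpenRing.reg (RegularOpenRing.val c ⊓ ⟨U, hU⟩) ≠ 0 := fun h =>
      absurd (RegularOpenRing.reg_eq_zero.1 h) (Opens.ne_bot_of_mem (x := y) ⟨hy, hyU⟩)
    refine ⟨_, RegularOpenRing.reg_mul_eq_left.2 inf_le_left, hU0, fun h => ?_⟩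
    have h1 : RegularOpenRing.reg (RegularOpenRing.val c ⊓ ⟨U, hU⟩) *
        RegularOpenRing.reg ⟨V, hV⟩ = 0 := by
      rw [RegularOpenRing.reg_mul, RegularOpenRing.reg_eq_zero]
      exact Opens.ext (Set.eq_empty_of_forall_notMem fun z hz =>
        Set.disjoint_left.1 hUV hz.1.2 hz.2)
    rw [h, ← RegularOpenRing.reg_val c, RegularOpenRing.reg_mul,
      RegularOpenRing.reg_eq_zero] at h1
    exact absurd h1 (Opens.ne_bot_of_mem (x := x) ⟨hx, hxV⟩)
  · obtain ⟨x, hx⟩ := hne hc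
    obtain ⟨_, ⟨n, rfl⟩, hxn, hn⟩ :=
      hb.exists_subset_of_mem_open hx (RegularOpenRing.val c).isOpen
    refine ⟨n, fun h => ?_, RegularOpenRing.reg_mul_eq_left.2 hn⟩
    exact Opens.ne_bot_of_mem hxn (RegularOpenRing.reg_eq_zero.1 h)

/-! ### Spaces of maximal ideals -/

namespace MaximalSpectrum

section

variable {R : Type u} {S : Type v} [CommRing R] [CommRing S]

/-- The set of all maximal ideals that do not contain `a`. -/
def basicOpen (a : R) : Set (MaximalSpectrum R) := {M | a ∉ M.asIdeal}

theorem isTopologicalBasis_basicOpen :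
    IsTopologicalBasis (Set.range (basicOpen : R → Set (MaximalSpectrum R))) := by
  have h := PrimeSpectrum.isTopologicalBasis_basic_opens.induced (toPrimeSpectrum (R := R))
  rw [← Set.range_comp] at h
  exact h

theorem isOpen_basicOpen (a : R) : IsOpen (basicOpen a) :=
  isTopologicalBasis_basicOpen.isOpen ⟨a, rfl⟩

/-- The preimages of maximal ideals under an isomorphism. -/
def comapEquiv (e : R ≃+* S) (M : MaximalSpectrum S) : MaximalSpectrum R :=
  ⟨M.asIdeal.comap e, Ideal.comap_isMaximal_of_equiv e⟩

theorem continuous_comapEquiv (e : R ≃+* S) : Continuous (comapEquiv e) :=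
  isTopologicalBasis_basicOpen.continuous_iff.2 <| by
    rintro _ ⟨a, rfl⟩
    exact isOpen_basicOpen (e a)

/-- Isomorphic rings have homeomorphic spaces of maximal ideals. -/
def homeomorphOfRingEquiv (e : R ≃+* S) : MaximalSpectrum R ≃ₜ MaximalSpectrum S where
  toFun := comapEquiv e.symm
  invFun := comapEquiv e
  left_inv M := MaximalSpectrum.ext <| Ideal.ext fun x => by
    change e.symm (e x) ∈ M.asIdeal ↔ _
    rw [e.symm_apply_apply]
  right_inv M := MaximalSpectrum.ext <| Ideal.ext fun x => by
    change e (e.symm x) ∈ M.asIdeal ↔ _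
    rw [e.apply_symm_apply]
  continuous_toFun := continuous_comapEquiv _
  continuous_invFun := continuous_comapEquiv _

end

section Boolean

variable {R : Type u} [CommRing R]

theorem mem_or_one_sub_mem (hR : ∀ x : R, x * x = x) {P : Ideal R} (hP : P.IsPrime) (x : R) :
    x ∈ P ∨ 1 - x ∈ P :=
  hP.mem_or_mem (by rw [mul_sub, mul_one, hR, sub_self]; exact P.zero_mem)

theorem isMaximal_of_mem_or {I : Ideal R} (h1 : (1 : R) ∉ I) (h : ∀ x, x ∈ I ∨ 1 - x ∈ I) :
    I.IsMaximal := by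
  refine Ideal.isMaximal_iff.2 ⟨h1, fun J x hIJ hx hxJ => ?_⟩
  have := J.add_mem (hIJ ((h x).resolve_left hx)) hxJ
  rwa [sub_add_cancel] at this

theorem exists_notMem_of_ne_zero (hR : ∀ x : R, x * x = x) {x : R} (hx : x ≠ 0) :
    ∃ M : MaximalSpectrum R, x ∉ M.asIdeal := by
  obtain ⟨M, hM, h⟩ := exists_max_ideal_of_mem_nonunits (a := 1 - x) fun h => hx <| by
    refine h.mul_left_eq_zero.1 ?_
    rw [mul_sub, mul_one, hR, sub_self]
  refine ⟨⟨M, hM⟩, fun hxM => hM.ne_top ((Ideal.eq_top_iff_one M).2 ?_)⟩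
  have := M.add_mem h hxM
  rwa [sub_add_cancel] at this

/-- Prime ideals of a Boolean ring are maximal, so this is the whole prime spectrum. -/
theorem compactSpace_of_idem (hR : ∀ x : R, x * x = x) : CompactSpace (MaximalSpectrum R) := by
  refine ⟨(Topology.IsInducing.isCompact_iff ⟨rfl⟩ (f := toPrimeSpectrum)).2 ?_⟩
  rw [Set.image_univ, Set.range_eq_univ.2]
  · exact isCompact_univ
  · intro P
    exact ⟨⟨P.asIdeal, isMaximal_of_mem_or (fun h => P.isPrime.ne_top
      ((Ideal.eq_top_iff_one _).2 h)) (mem_or_one_sub_mem hR P.isPrime)⟩, rfl⟩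

theorem notMem_iff (hR : ∀ x : R, x * x = x) (M : MaximalSpectrum R) (x : R) :
    x ∉ M.asIdeal ↔ 1 - x ∈ M.asIdeal := by
  refine ⟨(mem_or_one_sub_mem hR M.isMaximal.isPrime x).resolve_left, fun h hx => ?_⟩
  have := M.asIdeal.add_mem h hx
  rw [sub_add_cancel] at this
  exact M.isMaximal.ne_top ((Ideal.eq_top_iff_one _).2 this)

/-- The closure of `W` is the clopen set of the supremum `s` of all `a` with `basicOpen a ⊆ W`: if
`basicOpen b` misses `W`, then `b` is disjoint from each such `a`, hence from `s`. -/
theorem extremallyDisconnected_of_hasBooleanSups (hR : ∀ x : R, x * x = x)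
    (sR : HasBooleanSups R) : ExtremallyDisconnected (MaximalSpectrum R) := by
  refine ⟨fun W hW => ?_⟩
  obtain ⟨s, hs, hs'⟩ := sR {a | basicOpen a ⊆ W}
  have : closure W = basicOpen s := by
    refine (closure_minimal (fun M hM => ?_) ?_).antisymm fun M hM => ?_
    · obtain ⟨_, ⟨a, rfl⟩, ha, haW⟩ :=
        isTopologicalBasis_basicOpen.exists_subset_of_mem_open hM hW
      intro h
      refine ha ?_
      rw [← hs a haW]
      exact M.asIdeal.mul_mem_left a h
    · rw [← isOpen_compl_iff]
      convert isOpen_basicOpen (1 - s) using 1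
      ext M
      change ¬ (s ∉ M.asIdeal) ↔ 1 - s ∉ M.asIdeal
      rw [notMem_iff hR]
    · refine isTopologicalBasis_basicOpen.mem_closure_iff.2 ?_
      rintro _ ⟨b, rfl⟩ hb
      by_contra hbW
      have h1 : s * (1 - b) = s := hs' _ fun a ha => by
        suffices h : a * b = 0 by rw [mul_sub, mul_one, h, sub_zero]
        by_contra hab
        obtain ⟨N, hN⟩ := exists_notMem_of_ne_zero hR hab
        exact hbW ⟨N, fun h => hN (N.asIdeal.mul_mem_left a h),
          ha fun h => hN (N.asIdeal.mul_mem_right b h)⟩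
      have h2 : s * b ∈ M.asIdeal := by
        rw [show s * b = 0 by linear_combination -h1]
        exact M.asIdeal.zero_mem
      exact (M.isMaximal.isPrime.mem_or_mem h2).elim hM hb
  rw [this]
  exact isOpen_basicOpen s

end Boolean

section Regular

variable {Q : Type u} [CommRing Q]

open IdempotentRing

theorem _root_.IdempotentRing.val_add (x y : IdempotentRing Q) :
    val (x + y) = val x + val y - 2 * val x * val y := by
  have hx := val_mul_self x
  have h : val (x + y) = val x * (1 - val y) + val y * (1 - val x) -
    val x * (1 - val y) * (val y * (1 - val x)) := rfl
  rw [h]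
  linear_combination (val y - val y * val y) * hx

/-- The idempotents contained in a maximal ideal. -/
def idempotents (M : MaximalSpectrum Q) : MaximalSpectrum (IdempotentRing Q) where
  asIdeal :=
    { carrier := {x | val x ∈ M.asIdeal}
      add_mem' := fun {x y} hx hy => by
        change val (x + y) ∈ M.asIdeal
        rw [val_add]
        exact sub_mem (add_mem hx hy) (M.asIdeal.mul_mem_left _ hy)
      zero_mem' := M.asIdeal.zero_mem
      smul_mem' := fun a x hx => M.asIdeal.mul_mem_left (val a) hx }
  isMaximal := isMaximal_of_mem_or
    (fun h => M.isMaximal.ne_top ((Ideal.eq_top_iff_one _).2 h)) fun x => by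
      change val x ∈ M.asIdeal ∨ val (1 - x) ∈ M.asIdeal
      rw [BooleanRing.sub_eq_add, val_one_add]
      refine M.isMaximal.isPrime.mem_or_mem ?_
      rw [mul_sub, mul_one, val_mul_self, sub_self]
      exact M.asIdeal.zero_mem

theorem mem_idempotents {M : MaximalSpectrum Q} {x : IdempotentRing Q} :
    x ∈ (idempotents M).asIdeal ↔ val x ∈ M.asIdeal := Iff.rfl

theorem continuous_idempotents : Continuous (idempotents (Q := Q)) :=
  isTopologicalBasis_basicOpen.continuous_iff.2 <| by
    rintro _ ⟨a, rfl⟩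
    exact isOpen_basicOpen (val a)

/-- The elements fixed by some idempotent of `N` form a proper ideal; any maximal ideal above it
induces `N`. -/
theorem idempotents_surjective : Function.Surjective (idempotents (Q := Q)) := by
  intro N
  let I : Ideal Q :=
    { carrier := {q | ∃ x ∈ N.asIdeal, val x * q = q}
      add_mem' := by
        rintro p q ⟨x, hx, hp⟩ ⟨y, hy, hq⟩
        -- The join of `x` and `y`.
        refine ⟨1 + (1 + x) * (1 + y), ?_, ?_⟩
        · rw [show 1 + (1 + x) * (1 + y) = x + y * (1 + x) by
            linear_combination add_self_of_idem BooleanRing.mul_self (1 : IdempotentRing Q)]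
          exact add_mem hx (N.asIdeal.mul_mem_right _ hy)
        · simp only [val_one_add, val_mul]
          linear_combination (1 - val y) * hp + (1 - val x) * hq
      zero_mem' := ⟨0, N.asIdeal.zero_mem, mul_zero _⟩
      smul_mem' := by
        rintro a q ⟨x, hx, hq⟩
        exact ⟨x, hx, by rw [smul_eq_mul, mul_left_comm, hq]⟩ }
  have hI : I ≠ ⊤ := fun h => by
    obtain ⟨x, hx, h1⟩ := (Ideal.eq_top_iff_one I).1 h
    rw [mul_one] at h1
    rw [show x = 1 from val_injective h1] at hx
    exact N.isMaximal.ne_top ((Ideal.eq_top_iff_one _).2 hx)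
  obtain ⟨M, hM, hIM⟩ := Ideal.exists_le_maximal I hI
  refine ⟨⟨M, hM⟩, MaximalSpectrum.ext ?_⟩
  refine (N.isMaximal.eq_of_le (idempotents ⟨M, hM⟩).isMaximal.ne_top fun x hx => ?_).symm
  exact hIM ⟨x, hx, val_mul_self x⟩

/-- The idempotent that generates the same ideal as a given element. -/
theorem exists_val_mem_iff (hQ : ∀ q : Q, ∃ r, q * r * q = q) (q : Q) :
    ∃ x : IdempotentRing Q, ∀ M : MaximalSpectrum Q, val x ∈ M.asIdeal ↔ q ∈ M.asIdeal := by
  obtain ⟨r, hr⟩ := hQ q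
  refine ⟨ofIdem (q * r) (by linear_combination r * hr), fun M => ⟨fun h => ?_, fun h => ?_⟩⟩
  · rw [← hr]
    exact M.asIdeal.mul_mem_right q h
  · exact M.asIdeal.mul_mem_right r h

/-- A von Neumann regular ring has the same maximal ideals as its Boolean ring of idempotents. -/
theorem exists_homeomorph_idempotentRing (hQ : ∀ q : Q, ∃ r, q * r * q = q) :
    Nonempty (MaximalSpectrum Q ≃ₜ MaximalSpectrum (IdempotentRing Q)) := by
  have hinj : Function.Injective (idempotents (Q := Q)) := fun M M' h => by
    refine MaximalSpectrum.ext (Ideal.ext fun q => ?_)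
    obtain ⟨x, hx⟩ := exists_val_mem_iff hQ q
    rw [← hx M, ← hx M', ← mem_idempotents, h, mem_idempotents]
  refine ⟨(Equiv.ofBijective _ ⟨hinj, idempotents_surjective⟩).toHomeomorphOfContinuousOpen
    continuous_idempotents (isTopologicalBasis_basicOpen.isOpenMap_iff.2 ?_)⟩
  rintro _ ⟨q, rfl⟩
  obtain ⟨x, hx⟩ := exists_val_mem_iff hQ q
  convert isOpen_basicOpen x using 1
  ext N
  obtain ⟨M, rfl⟩ := idempotents_surjective N
  refine (hinj.mem_set_image).trans ?_
  exact (not_congr (hx M)).symm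

end Regular

end MaximalSpectrum

/-! ### Limits of maximal ideals of regular open sets -/

theorem RegularOpenRing.val_one_sub {Y : Type u} [TopologicalSpace Y] (c : RegularOpenRing Y) :
    val (1 - c) = (val c)ᶜ := by
  change (ofBoolRing (1 - c)).val = _
  rw [ofBoolRing_sub, ofBoolRing_one, top_symmDiff]
  rfl

theorem RegularOpenRing.mul_one_sub_self {Y : Type u} [TopologicalSpace Y]
    (c : RegularOpenRing Y) : c * (1 - c) = 0 := by
  rw [mul_sub, mul_one, mul_self', sub_self]

theorem RegularOpenRing.notMem_of_mul_eq_zero {Y : Type u} [TopologicalSpace Y]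
    {c d : RegularOpenRing Y} (h : c * d = 0) {y : Y} (hc : y ∈ val c) : y ∉ val d := fun hd => by
  have : y ∈ val (c * d) := ⟨hc, hd⟩
  rw [h] at this
  exact this

namespace StoneCechLimit

open RegularOpenRing

variable {Y : Type u} [TopologicalSpace Y]

/-- The trace of a regular open set on a subspace, as a subset of the compactification of the
subspace. -/
def trace (S : Set Y) (c : RegularOpenRing Y) : Set (StoneCech S) :=
  stoneCechUnit '' {x : S | x.1 ∈ val c}

/-- The point `p` of `βS` is a limit of the ultrafilter of regular open sets that is complementary
to the maximal ideal `u`. -/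
def IsLimit (u : MaximalSpectrum (RegularOpenRing Y)) (S : Set Y) (p : StoneCech S) : Prop :=
  ∀ c ∉ u.asIdeal, p ∈ closure (trace S c)

theorem trace_mono (S : Set Y) {c d : RegularOpenRing Y} (h : val c ≤ val d) :
    trace S c ⊆ trace S d :=
  Set.image_mono fun _ hx => h hx

/-- The regular open set generated by an open subset of `βS`. -/
theorem exists_reg {S : Set Y} (hS : Dense S) {W : Set (StoneCech S)} (hW : IsOpen W) :
    ∃ c : RegularOpenRing Y, (∀ x : S, stoneCechUnit x ∈ W → x.1 ∈ val c) ∧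
      trace S c ⊆ closure W ∧
      ∀ d : RegularOpenRing Y, (∀ x : S, x.1 ∈ val d → stoneCechUnit x ∉ W) → d * c = 0 := by
  obtain ⟨W', hW', h⟩ := isOpen_induced_iff.1 (hW.preimage continuous_stoneCechUnit)
  replace h : ∀ x : S, x.1 ∈ W' ↔ stoneCechUnit x ∈ W := fun x => Set.ext_iff.1 h x
  -- Open subsets of `Y` that are disjoint on the dense set `S` are disjoint.
  have key : ∀ V : Opens Y, (∀ x : S, x.1 ∈ V → stoneCechUnit x ∉ W) → V ⊓ ⟨W', hW'⟩ = ⊥ := by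
    intro V hV
    by_contra hne
    obtain ⟨y, hy, hyS⟩ := hS.inter_open_nonempty _ (V ⊓ ⟨W', hW'⟩).isOpen
      ((Opens.ne_bot_iff_nonempty _).1 hne)
    exact hV ⟨y, hyS⟩ hy.1 ((h ⟨y, hyS⟩).1 hy.2)
  refine ⟨reg ⟨W', hW'⟩, fun x hx => ?_, ?_, fun d hd => ?_⟩
  · rw [val_reg]
    exact (le_compl_compl : (⟨W', hW'⟩ : Opens Y) ≤ _) ((h x).2 hx)
  · rintro _ ⟨x, hx, rfl⟩
    refine mem_closure_iff.2 fun N hN hxN => ?_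
    obtain ⟨N', hN', h'⟩ := isOpen_induced_iff.1 (hN.preimage continuous_stoneCechUnit)
    replace h' : ∀ x : S, x.1 ∈ N' ↔ stoneCechUnit x ∈ N := fun x => Set.ext_iff.1 h' x
    by_contra hNW
    have h1 := key ⟨N', hN'⟩ fun y hy hyW => hNW ⟨_, (h' y).1 hy, hyW⟩
    rw [← reg_eq_zero, ← reg_mul] at h1
    refine notMem_of_mul_eq_zero h1 (y := x.1) ?_ hx
    rw [val_reg]
    exact (le_compl_compl : (⟨N', hN'⟩ : Opens Y) ≤ _) ((h' x).2 hxN)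
  · rw [← reg_val d, reg_mul, reg_eq_zero]
    exact key _ hd

/-- Otherwise `1 - c` belongs to the ultrafilter, so its trace meets `W`, all of whose points from
`S` lie in `c`. -/
theorem notMem_of_isLimit {u : MaximalSpectrum (RegularOpenRing Y)} {S : Set Y}
    {p : StoneCech S} (hp : IsLimit u S p) {W : Set (StoneCech S)} (hW : IsOpen W) (hpW : p ∈ W)
    {c : RegularOpenRing Y} (hc : ∀ x : S, stoneCechUnit x ∈ W → x.1 ∈ val c) :
    c ∉ u.asIdeal := by
  intro hcu
  have h1 : 1 - c ∉ u.asIdeal := fun h =>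
    (MaximalSpectrum.notMem_iff mul_self' u c).2 h hcu
  obtain ⟨_, hxW, x, hx, rfl⟩ := mem_closure_iff.1 (hp _ h1) W hW hpW
  exact notMem_of_mul_eq_zero (mul_one_sub_self c) (hc x hxW) hx

theorem isLimit_unique {u : MaximalSpectrum (RegularOpenRing Y)} {S : Set Y} (hS : Dense S)
    {p q : StoneCech S} (hp : IsLimit u S p) (hq : IsLimit u S q) : p = q := by
  by_contra hpq
  obtain ⟨W, V, hW, hV, hpW, hqV, hWV⟩ := t2_separation hpq
  obtain ⟨c, hc, hc', -⟩ := exists_reg hS hW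
  have h1 := closure_minimal hc' isClosed_closure (hq c (notMem_of_isLimit hp hW hpW hc))
  exact Set.disjoint_left.1 (hWV.closure_left hV) h1 hqV

/-- By compactness of `βS`: closures of traces are nonempty and directed, since the ultrafilter is
closed under products. -/
theorem exists_isLimit (u : MaximalSpectrum (RegularOpenRing Y)) {S : Set Y} (hS : Dense S) :
    ∃ p, IsLimit u S p := by
  have hprime := u.isMaximal.isPrime
  have : Nonempty {c // c ∉ u.asIdeal} :=
    ⟨1, fun h => hprime.ne_top ((Ideal.eq_top_iff_one _).2 h)⟩
  have hne : (⋂ c : {c // c ∉ u.asIdeal}, closure (trace S c.1)).Nonempty := by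
    refine IsCompact.nonempty_iInter_of_directed_nonempty_isCompact_isClosed _ (fun c d => ?_)
      (fun c => ?_) (fun c => isClosed_closure.isCompact) fun c => isClosed_closure
    · refine ⟨⟨c.1 * d.1, fun h => (hprime.mem_or_mem h).elim c.2 d.2⟩, ?_, ?_⟩
      · exact closure_mono (trace_mono S inf_le_left)
      · exact closure_mono (trace_mono S inf_le_right)
    · have hc : c.1 ≠ 0 := fun h => c.2 (h ▸ zero_mem _)
      obtain ⟨y, hy, hyS⟩ := hS.inter_open_nonempty _ (val c.1).isOpen
        ((Opens.ne_bot_iff_nonempty _).1 fun h => hc (val_injective h))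
      exact ⟨_, subset_closure ⟨⟨y, hyS⟩, hy, rfl⟩⟩
  obtain ⟨p, hp⟩ := hne
  exact ⟨p, fun c hc => Set.mem_iInter.1 hp ⟨c, hc⟩⟩

/-- The limit in `βS`. -/
noncomputable def lim {S : Set Y} (hS : Dense S) (u : MaximalSpectrum (RegularOpenRing Y)) :
    StoneCech S :=
  (exists_isLimit u hS).choose

theorem isLimit_lim {S : Set Y} (hS : Dense S) (u : MaximalSpectrum (RegularOpenRing Y)) :
    IsLimit u S (lim hS u) :=
  (exists_isLimit u hS).choose_spec

/-- For a closed neighbourhood `V` of the limit, the interior of `V` generates some `c ∉ u`, and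
every ideal omitting `c` has its limit in `V`. -/
theorem continuous_lim {S : Set Y} (hS : Dense S) : Continuous (lim hS) := by
  refine continuous_iff_continuousAt.2 fun u => ?_
  refine fun N hN => ?_
  obtain ⟨V, hVp, hVc, hVN⟩ := exists_mem_nhds_isClosed_subset hN
  obtain ⟨c, hc, hc', -⟩ := exists_reg hS (isOpen_interior (s := V))
  have hcu := notMem_of_isLimit (isLimit_lim hS u) isOpen_interior (mem_interior_iff_mem_nhds.2 hVp)
    hc
  refine Filter.mem_map.2 (Filter.mem_of_superset
    ((MaximalSpectrum.isOpen_basicOpen c).mem_nhds hcu) fun v hv => hVN ?_)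
  exact closure_minimal (hc'.trans (closure_minimal interior_subset hVc)) hVc
    (isLimit_lim hS v c hv)

theorem stoneCechInclusion_unit {S T : Set Y} (h : S ⊆ T) (x : S) :
    stoneCechInclusion h (stoneCechUnit x) = stoneCechUnit (Set.inclusion h x) :=
  stoneCechExtend_stoneCechUnit _ x

theorem continuous_stoneCechInclusion {S T : Set Y} (h : S ⊆ T) :
    Continuous (stoneCechInclusion h) :=
  continuous_stoneCechExtend _

theorem stoneCechInclusion_lim {S T : Set Y} (hS : Dense S) (hT : Dense T) (h : S ⊆ T)
    (u : MaximalSpectrum (RegularOpenRing Y)) : stoneCechInclusion h (lim hS u) = lim hT u := by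
  refine isLimit_unique hT (fun c hc => ?_) (isLimit_lim hT u)
  refine map_mem_closure (continuous_stoneCechInclusion h) (isLimit_lim hS u c hc) ?_
  rintro _ ⟨x, hx, rfl⟩
  rw [stoneCechInclusion_unit]
  exact ⟨Set.inclusion h x, hx, rfl⟩

theorem dense_union_compl (c : RegularOpenRing Y) :
    Dense ((val c : Set Y) ∪ (val (1 - c) : Set Y)) := by
  refine dense_iff_inter_open.2 fun N hN hne => ?_
  by_contra h
  have h1 : (⟨N, hN⟩ : Opens Y) ⊓ val c = ⊥ := Opens.ext <|
    Set.eq_empty_of_forall_notMem fun y hy => h ⟨y, hy.1, Or.inl hy.2⟩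
  obtain ⟨y, hy⟩ := hne
  refine h ⟨y, hy, Or.inr ?_⟩
  rw [val_one_sub]
  exact (le_compl_iff_disjoint_right.2 (disjoint_iff.2 h1) : (⟨N, hN⟩ : Opens Y) ≤ _) hy

/-- If `c` separates `u` from `v`, it splits the dense open set `c ∪ (1 - c)` into two clopen
pieces; its indicator extends to `βS` and separates the limits. -/
theorem isLimit_injective {u v : MaximalSpectrum (RegularOpenRing Y)}
    (h : ∀ S : Set Y, IsOpen S → Dense S → ∃ p, IsLimit u S p ∧ IsLimit v S p) : u = v := by
  suffices hle : v.asIdeal ≤ u.asIdeal from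
    MaximalSpectrum.ext (v.isMaximal.eq_of_le u.isMaximal.ne_top hle).symm
  intro c hcv
  by_contra hcu
  have hcv' : 1 - c ∉ v.asIdeal := fun h => (MaximalSpectrum.notMem_iff mul_self' v c).2 h hcv
  let S : Set Y := (val c : Set Y) ∪ (val (1 - c) : Set Y)
  obtain ⟨p, hp, hp'⟩ := h S ((val c).isOpen.union (val (1 - c)).isOpen) (dense_union_compl c)
  let U : Set S := {x | x.1 ∈ val c}
  have hU : IsClopen U := by
    refine ⟨?_, (val c).isOpen.preimage continuous_subtype_val⟩
    rw [← isOpen_compl_iff]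
    convert (val (1 - c)).isOpen.preimage continuous_subtype_val using 1
    ext x
    exact ⟨fun hx => x.2.resolve_left hx, fun hx hx' =>
      notMem_of_mul_eq_zero (mul_one_sub_self c) hx' hx⟩
  let f := stoneCechExtend ((continuous_boolIndicator_iff_isClopen U).2 hU)
  have hf : Continuous f := continuous_stoneCechExtend _
  have h1 : f p = true := by
    refine closure_minimal (t := f ⁻¹' {true}) ?_ (isClosed_discrete _ |>.preimage hf) (hp c hcu)
    rintro _ ⟨x, hx, rfl⟩
    exact (stoneCechExtend_stoneCechUnit _ x).trans ((Set.mem_iff_boolIndicator U x).1 hx)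
  have h2 : f p = false := by
    refine closure_minimal (t := f ⁻¹' {false}) ?_ (isClosed_discrete _ |>.preimage hf)
      (hp' _ hcv')
    rintro _ ⟨x, hx, rfl⟩
    exact (stoneCechExtend_stoneCechUnit _ x).trans ((Set.notMem_iff_boolIndicator U x).1
      fun hx' => notMem_of_mul_eq_zero (mul_one_sub_self c) hx' hx)
  rw [h1] at h2
  exact Bool.noConfusion h2

end StoneCechLimit

/-! ### The space `K` -/

namespace KSpace

open StoneCechLimit RegularOpenRing

variable {X : Type u} [TopologicalSpace X]

/-- The point of `K(X)` determined by a maximal ideal of regular open subsets of `βX`. -/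
noncomputable def ofMaximal (u : MaximalSpectrum (RegularOpenRing (StoneCech X))) : KSpace X :=
  ⟨fun S => lim S.2.2 u, fun S T h => stoneCechInclusion_lim S.2.2 T.2.2 h u⟩

theorem continuous_ofMaximal : Continuous (ofMaximal (X := X)) :=
  Continuous.subtype_mk (continuous_pi fun S => continuous_lim S.2.2) _

theorem ofMaximal_injective : Function.Injective (ofMaximal (X := X)) := fun u v h =>
  isLimit_injective fun S hSo hS => ⟨lim hS u, isLimit_lim hS u, by
    have h1 : lim hS u = lim hS v := congrFun (congrArg Subtype.val h) ⟨S, hSo.isGδ, hS⟩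
    rw [h1]
    exact isLimit_lim hS v⟩

/-- The regular open set contains the trace of a neighbourhood of a coordinate of `k`. -/
def IsNeighbourhood (k : KSpace X) (c : RegularOpenRing (StoneCech X)) : Prop :=
  ∃ (S : {S : Set (StoneCech X) // IsGδ S ∧ Dense S}) (W : Set (StoneCech S.1)),
    IsOpen W ∧ k.1 S ∈ W ∧ ∀ x : S.1, stoneCechUnit x ∈ W → x.1 ∈ val c

theorem IsNeighbourhood.mono {k : KSpace X} {c d : RegularOpenRing (StoneCech X)}
    (hc : IsNeighbourhood k c) (h : c * d = c) : IsNeighbourhood k d := by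
  obtain ⟨S, W, hW, hk, hWc⟩ := hc
  exact ⟨S, W, hW, hk, fun x hx => mul_eq_left.1 h (hWc x hx)⟩

/-- Both neighbourhoods are pulled back to the intersection of the two dense `G_δ` sets, which is
dense by Baire's theorem in `βX`. -/
theorem IsNeighbourhood.mul {k : KSpace X} {c d : RegularOpenRing (StoneCech X)}
    (hc : IsNeighbourhood k c) (hd : IsNeighbourhood k d) : IsNeighbourhood k (c * d) := by
  obtain ⟨S, W, hW, hk, hWc⟩ := hc
  obtain ⟨T, V, hV, hk', hVd⟩ := hd
  let R : {S : Set (StoneCech X) // IsGδ S ∧ Dense S} :=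
    ⟨S.1 ∩ T.1, S.2.1.inter T.2.1, Dense.inter_of_Gδ S.2.1 T.2.1 S.2.2 T.2.2⟩
  have hRS : R.1 ⊆ S.1 := Set.inter_subset_left
  have hRT : R.1 ⊆ T.1 := Set.inter_subset_right
  refine ⟨R, stoneCechInclusion hRS ⁻¹' W ∩ stoneCechInclusion hRT ⁻¹' V,
    (hW.preimage (continuous_stoneCechInclusion hRS)).inter
      (hV.preimage (continuous_stoneCechInclusion hRT)), ⟨?_, ?_⟩, fun x hx => ⟨?_, ?_⟩⟩
  · rw [Set.mem_preimage, k.2 R S hRS]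
    exact hk
  · rw [Set.mem_preimage, k.2 R T hRT]
    exact hk'
  · have := hx.1
    rw [Set.mem_preimage, stoneCechInclusion_unit] at this
    exact hWc _ this
  · have := hx.2
    rw [Set.mem_preimage, stoneCechInclusion_unit] at this
    exact hVd _ this

theorem not_isNeighbourhood_zero (k : KSpace X) : ¬ IsNeighbourhood k 0 := by
  rintro ⟨S, W, hW, hk, h⟩
  obtain ⟨x, hx⟩ := denseRange_stoneCechUnit.exists_mem_open hW ⟨_, hk⟩
  exact h x hx

theorem isNeighbourhood_one (k : KSpace X) : IsNeighbourhood k 1 :=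
  ⟨⟨Set.univ, IsGδ.univ, dense_univ⟩, Set.univ, isOpen_univ, trivial, fun _ _ => trivial⟩

/-- The ideal of all regular open sets whose complements are neighbourhoods of `k`. -/
def ideal (k : KSpace X) : Ideal (RegularOpenRing (StoneCech X)) where
  carrier := {c | IsNeighbourhood k (1 - c)}
  -- The complement of the join of `a` and `b` lies below the complement of their sum.
  add_mem' {a b} ha hb := (ha.mul hb).mono <| by
    linear_combination (1 - b) * mul_self' a + (1 - a) * mul_self' b
  zero_mem' := by
    change IsNeighbourhood k (1 - 0)
    rw [sub_zero]
    exact isNeighbourhood_one k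
  smul_mem' a b hb := IsNeighbourhood.mono hb <| by
    rw [smul_eq_mul]
    linear_combination a * mul_self' b

/-- Extend the ideal of `k` to a maximal ideal. If a coordinate of `k` avoids the closure of the
trace of `c`, the complement of that closure generates a neighbourhood of `k` disjoint from `c`,
which forces `c` into the maximal ideal. -/
theorem ofMaximal_surjective : Function.Surjective (ofMaximal (X := X)) := by
  intro k
  have hk : ideal k ≠ ⊤ := fun h => by
    have h1 : IsNeighbourhood k (1 - 1) := (Ideal.eq_top_iff_one _).1 h
    rw [sub_self] at h1
    exact not_isNeighbourhood_zero k h1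
  obtain ⟨M, hM, hkM⟩ := Ideal.exists_le_maximal _ hk
  let u : MaximalSpectrum (RegularOpenRing (StoneCech X)) := ⟨M, hM⟩
  refine ⟨u, Subtype.ext (funext fun S => isLimit_unique S.2.2 (isLimit_lim S.2.2 u) ?_)⟩
  intro c hc
  by_contra hkc
  obtain ⟨d, hd, -, hd'⟩ := exists_reg S.2.2 (isClosed_closure (s := trace S.1 c)).isOpen_compl
  have h1 : c * d = 0 := hd' c fun x hx h => h (subset_closure ⟨x, hx, rfl⟩)
  have h2 : 1 - d ∈ M := hkM <| by
    change IsNeighbourhood k (1 - (1 - d))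
    rw [sub_sub_cancel]
    exact ⟨S, _, isClosed_closure.isOpen_compl, hkc, hd⟩
  refine hc ?_
  rw [show c = c * (1 - d) by linear_combination h1]
  exact M.mul_mem_left c h2

instance : T2Space (KSpace X) :=
  inferInstanceAs (T2Space (Subtype _))

/-- The space `K(X)` is the space of maximal ideals of the regular open subsets of `βX`. -/
noncomputable def homeomorphMaximalSpectrum (X : Type u) [TopologicalSpace X] :
    MaximalSpectrum (RegularOpenRing (StoneCech X)) ≃ₜ KSpace X :=
  have := MaximalSpectrum.compactSpace_of_idem (mul_self' (X := StoneCech X))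
  Continuous.homeoOfEquivCompactToT2
    (f := Equiv.ofBijective _ ⟨ofMaximal_injective, ofMaximal_surjective⟩) continuous_ofMaximal

end KSpace

/-! ### Passage from `βX` to `X`, and conclusion -/

/-- The Stone–Čech compactification has the same regular open sets. -/
theorem exists_ringEquiv_regularOpenRing_stoneCech (X : Type u) [TopologicalSpace X]
    [CompletelyRegularSpace X] :
    Nonempty (RegularOpenRing X ≃+* RegularOpenRing (StoneCech X)) := by
  let f (V : Opens (StoneCech X)) : Opens X := Opens.comap ⟨_, continuous_stoneCechUnit⟩ V
  have hf : ∀ V, f V = ⊥ ↔ V = ⊥ := fun V => by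
    refine ⟨fun h => ?_, fun h => ?_⟩
    · by_contra hV
      obtain ⟨x, hx⟩ := denseRange_stoneCechUnit.exists_mem_open V.isOpen
        ((Opens.ne_bot_iff_nonempty V).1 hV)
      exact Opens.ne_bot_of_mem (U := f V) (x := x) hx h
    · rw [h]
      rfl
  refine exists_ringEquiv_of_dense RegularOpenRing.mul_self' RegularOpenRing.mul_self'
    RegularOpenRing.hasBooleanSups RegularOpenRing.hasBooleanSups
    (RegularOpenRing.isDenseFamily_reg (j := fun V : {V : Opens (StoneCech X) // V ≠ ⊥} => f V.1)
      (fun V h => V.2 ((hf _).1 h)) fun U hU => ?_)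
    (RegularOpenRing.isDenseFamily_reg (j := Subtype.val) (fun V => V.2) fun V hV =>
      ⟨⟨V, hV⟩, le_rfl⟩) fun V W => ?_
  · obtain ⟨V, hV, h⟩ := isInducing_stoneCechUnit.isOpen_iff.1 U.isOpen
    have h' : f ⟨V, hV⟩ = U := Opens.ext h
    exact ⟨⟨⟨V, hV⟩, fun h0 => hU (by rw [← h', (hf _).2 h0])⟩, h'.le⟩
  · rw [RegularOpenRing.reg_mul, RegularOpenRing.reg_mul, RegularOpenRing.reg_eq_zero,
      RegularOpenRing.reg_eq_zero, ← hf (V.1 ⊓ W.1)]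
    rfl

theorem exists_homeomorph_regularOpenRing_kSpace (X : Type u) [TopologicalSpace X]
    [CompletelyRegularSpace X] :
    Nonempty (MaximalSpectrum (RegularOpenRing X) ≃ₜ KSpace X) := by
  obtain ⟨e⟩ := exists_ringEquiv_regularOpenRing_stoneCech X
  exact ⟨(MaximalSpectrum.homeomorphOfRingEquiv e).trans (KSpace.homeomorphMaximalSpectrum X)⟩

/-- The maximal ideals of `Q(X)` are those of the regular open sets. -/
theorem exists_homeomorph_qRing (X : Type u) [TopologicalSpace X] [CompletelyRegularSpace X] :
    Nonempty (MaximalSpectrum (QRing X) ≃ₜ MaximalSpectrum (RegularOpenRing X)) := by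
  obtain ⟨e⟩ := MaximalSpectrum.exists_homeomorph_idempotentRing
    (Q := QRing X) MaxQuotientRing.exists_mul_mul_eq_self
  obtain ⟨f⟩ := exists_ringEquiv_idempotentRing X
  exact ⟨e.trans (MaximalSpectrum.homeomorphOfRingEquiv f)⟩

theorem extremallyDisconnected_of_homeomorph {Y Z : Type*} [TopologicalSpace Y]
    [TopologicalSpace Z] [ExtremallyDisconnected Y] (e : Y ≃ₜ Z) : ExtremallyDisconnected Z := by
  refine ⟨fun U hU => ?_⟩
  rw [← e.isOpen_preimage, e.preimage_closure]
  exact ExtremallyDisconnected.open_closure _ (hU.preimage e.continuous)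

/-- For second countable spaces without isolated points, the idempotents and the maximal ideals of
`Q(X)` do not depend on `X`. -/
theorem exists_iso_completion_freeBooleanRing (X : Type u) [TopologicalSpace X] [T35Space X]
    [SecondCountableTopology X] [Nonempty X] (hX : ∀ x : X, ¬ IsOpen ({x} : Set X)) :
    Nonempty (IdempotentRing (QRing X) ≃+* MaxQuotientRing (FreeBooleanRing ℕ)) ∧
    Nonempty (MaximalSpectrum (QRing X) ≃ₜ
      MaximalSpectrum (MaxQuotientRing (FreeBooleanRing ℕ))) := by
  obtain ⟨e⟩ := exists_ringEquiv_idempotentRing X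
  obtain ⟨f⟩ := exists_ringEquiv_regularOpenRing_completion X hX
  obtain ⟨g⟩ := exists_homeomorph_qRing X
  exact ⟨⟨e.trans f⟩, ⟨g.trans (MaximalSpectrum.homeomorphOfRingEquiv f)⟩⟩

theorem mainTheorem10 :
    (∀ (X : Type u) [TopologicalSpace X] [T35Space X],
      CompactSpace (KSpace X) ∧ T2Space (KSpace X) ∧ ExtremallyDisconnected (KSpace X) ∧
      Nonempty (MaximalSpectrum (RegularOpenRing X) ≃ₜ KSpace X)) ∧
    (∀ (X : Type u) [TopologicalSpace X] [T35Space X] [SecondCountableTopology X] [Nonempty X],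
      (∀ x : X, ¬ IsOpen ({x} : Set X)) →
      Nonempty (IdempotentRing (QRing X) ≃+* MaxQuotientRing (FreeBooleanRing ℕ)) ∧
      Nonempty (MaximalSpectrum (QRing X) ≃ₜ
        MaximalSpectrum (MaxQuotientRing (FreeBooleanRing ℕ))) ∧
      Nonempty (MaximalSpectrum (QRing X) ≃ₜ KSpace X)) ∧
    (∀ (X : Type u) [TopologicalSpace X] [T35Space X] [SecondCountableTopology X] [Nonempty X]
      (Y : Type v) [TopologicalSpace Y] [T35Space Y] [SecondCountableTopology Y] [Nonempty Y],
      (∀ x : X, ¬ IsOpen ({x} : Set X)) → (∀ y : Y, ¬ IsOpen ({y} : Set Y)) →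
      Nonempty (IdempotentRing (QRing X) ≃+* IdempotentRing (QRing Y)) ∧
      Nonempty (MaximalSpectrum (QRing X) ≃ₜ MaximalSpectrum (QRing Y))) ∧
    IsBooleanCompletion (MaxQuotientRing.of (FreeBooleanRing ℕ)) := by
  refine ⟨fun X _ _ => ?_, fun X _ _ _ _ hX => ⟨(exists_iso_completion_freeBooleanRing X hX).1, (exists_iso_completion_freeBooleanRing X hX).2, ?_⟩,
    fun X _ _ _ _ Y _ _ _ _ hX hY => ?_,
    MaxQuotientRing.isBooleanCompletion_of FreeBooleanRing.mul_self'⟩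
  · obtain ⟨e⟩ := exists_homeomorph_regularOpenRing_kSpace X
    have := MaximalSpectrum.compactSpace_of_idem (RegularOpenRing.mul_self' (X := X))
    have := MaximalSpectrum.extremallyDisconnected_of_hasBooleanSups
      (RegularOpenRing.mul_self' (X := X)) RegularOpenRing.hasBooleanSups
    exact ⟨e.compactSpace, inferInstance, extremallyDisconnected_of_homeomorph e, ⟨e⟩⟩
  · obtain ⟨e⟩ := exists_homeomorph_regularOpenRing_kSpace X
    obtain ⟨g⟩ := exists_homeomorph_qRing X
    exact ⟨g.trans e⟩
  · obtain ⟨⟨e⟩, ⟨f⟩⟩ := exists_iso_completion_freeBooleanRing X hX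
    obtain ⟨⟨e'⟩, ⟨f'⟩⟩ := exists_iso_completion_freeBooleanRing Y hY
    exact ⟨⟨e.trans e'.symm⟩, ⟨f.trans f'.symm⟩⟩
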